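/- **Setting.** Let $X_0,X_1$ be (real) Banach spaces, $X_1$ densely and continuously embedded in $X_0$, with norms $|\cdot|_0,|\cdot|_1$; let $U_1\subset X_1$ be open and $F\in C^k(U_1,X_0)$ for some $k\ge 1$. Consider $\dot u+F(u)=0$, $t>0$, $u(0)=u_0$, and let $\mathcal E=\{u\in U_1: F(u)=0\}$. Let $u_*\in\mathcal E$, $A=F'(u_*)$, and assume that $-A$, as an operator in $X_0$ with domain $X_1$, generates a strongly continuous analytic semigroup $e^{-At}$ on $X_0$. Put $G(z)=Az-F(z+u_*)$ for $z\in U_1-u_*$. Spectra are those of complexifications. For $J=[0,a)$, $a\in(0,\infty]$, let $\mathbb E_0(J)\hookrightarrow L_{1,loc}(J;X_0)$ and $\mathbb E_1(J)\hookrightarrow H^1_{1,loc}(J;X_0)\cap L_{1,loc}(J;X_1)$ be Banach spaces. The spaces $\mathbb E_1(J)$ are compatible with restriction (which does not increase norms), with translation in time, and with gluing of functions that overlap on an interval of positive length; and for bounded $J$ the constant functions with values in $X_1$ belong to $\mathbb E_1(J)$, with $\|x\|_{\mathbb E_1(J)}\le C_J|x|_1$. Set $\mathbb E_j([0,T])=\mathbb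 E_j([0,T))$. Let $X_\gamma=\gamma\mathbb E_1=\{w(0):w\in\mathbb E_1(J)\}$, with the quotient norm $|\cdot|_\gamma$. "Independent of $J$" refers to all $J=[0,a)$, $a\in(0,\infty]$. **Conditions**, for some $\omega>0$: - (A1) $\gamma\mathbb E_1$ does not depend on $J$ (up to equivalent norms), $\mathbb E_1(J)\hookrightarrow BUC(J;X_\gamma)$, and there is $c_0$ independent of $J$ with $\sup_{t\in J}|w(t)|_\gamma\le c_0\|w\|_{\mathbb E_1(J)}$ for all $w\in\mathbb E_1(J)$ with $w(0)=0$. - (A2) If $w\in\mathbb E_0(J)$, $\tilde w\in\mathbb E_1(J)$ and $|w(t)|_0\le|\tilde w(t)|_1$ for a.e. $t\in J$, then $\|w\|_{\mathbb E_0(J)}\le\|\tilde w\|_{\mathbb E_1(J)}$; there is $c_1$ independent of $J$ with $\int_J e^{-\omega s}|w(s)|_1ds\le c_1\|w\|_{\mathbb E_1(J)}$ for $w\in\mathbb E_1(J)$, and $\int_t^\infty e^{-\omega s}|w(s)|_1ds\le c_1e^{-\omega t}\|w\|_{\mathbb E_1(\mathbb R_+)}$ for $w\in\mathbb E_1(\mathbb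 R_+)$, $t\ge0$. - (A3) For every $I=[0,T]$ with $0<T<\infty$, $w\mapsto(\dot w+Aw,w(0))$ is a bijection from $\mathbb E_1(I)$ onto $\mathbb E_0(I)\times\gamma\mathbb E_1(I)$. - (A4) Let $P_s$ be the spectral projection of $A$ for $\sigma(A)\setminus\{0\}$ (under (iii) below: the projection onto $R(A)$ along $N(A)$), and $A_s$ the part of $A$ in $P_sX_0$. $P_s$ acts (pointwise in $t$) in each $\mathbb E_0(J)$. There is $M_0$ such that for all $J$, all $\sigma\in[0,\omega]$ and all $g$ with $e^{\sigma t}P_sg\in\mathbb E_0(J)$ there is a unique solution $w$, with $e^{\sigma t}w\in\mathbb E_1(J)$, of $\dot w+A_sw=P_sg$, $w(0)=0$, and $\|e^{\sigma t}w\|_{\mathbb E_1(J)}\le M_0\|e^{\sigma t}P_sg\|_{\mathbb E_0(J)}$. There is $M_1$ such that for all $J$, $\sigma\in[0,\omega]$, $z\in X_\gamma$: $\|e^{\sigma t}e^{-A_st}P_sz\|_{\mathbb E_1(J)}+\sup_{t\in J}|e^{\sigma t}e^{-A_st}P_sz|_\gamma\le M_1|P_sz|_\gamma$. - (A5) There is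 $C_1$ such that for every $\eta>0$ there is $r>0$ with $|G(z_1)-G(z_2)|_0\le C_1(\eta+|z_2|_1)|z_1-z_2|_1$ for all $z_1,z_2\in U_1-u_*$ with $|z_1|_\gamma,|z_2|_\gamma<r$. - (A6) For every $b>0$ there is $r_2>0$ such that for $|v_0|_\gamma<r_2$ the problem $\dot v+Av=G(v)$, $v(0)=v_0$, has a unique solution $v\in\mathbb E_1([0,b])$. **Theorem.** Assume (A1)–(A6), and let $u_*$ be normally stable, i.e. assume - (i) near $u_*$, $\mathcal E$ is an $m$-dimensional $C^1$-manifold in $X_1$: there are an open $U\subset\mathbb R^m$ with $0\in U$, a map $\Psi\in C^1(U,X_1)$ with $\Psi(0)=u_*$ and $\operatorname{rank}\Psi'(0)=m$, and $r_1>0$ with $\mathcal E\cap B_{X_1}(u_*,r_1)=\Psi(U)$; - (ii) the tangent space $R(\Psi'(0))$ of $\mathcal E$ at $u_*$ is $N(A)$; - (iii) $0$ is semi-simple for $A$: $N(A)\oplus R(A)=X_0$; - (iv) $\operatorname{Re}z>\omega$ for all $z\in\sigma(A)\setminus\{0\}$. Here solutions on $\mathbb R_+$ are taken in the class of functions that lie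 in $\mathbb E_1([0,T))$ for all finite $T$. Then $u_*$ is stable in $X_\gamma$: for every $\varepsilon>0$ there is $\delta>0$ such that whenever $|u_0-u_*|_\gamma<\delta$, a solution on $\mathbb R_+$ exists, and it satisfies $|u(t)-u_*|_\gamma<\varepsilon$ for all $t\ge0$. Moreover there are $\delta,\alpha>0$ and $M$ such that for every $u_0$ with $|u_0-u_*|_\gamma<\delta$ there is a unique solution $u$ on $\mathbb R_+$, and there is an equilibrium $u_\infty\in\Psi(U)\subset\mathcal E$ with $|u(t)-u_\infty|_\gamma\le Me^{-\alpha t}$ for all $t\ge0$. -/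

import Mathlib

open Set Filter Topology MeasureTheory
open scoped ENNReal NNReal

noncomputable section

namespace MaxReg

/-- The time interval `J = [0, a)`, for `a ∈ (0, ∞]`. -/
def timeInterval (a : ℝ≥0∞) : Set ℝ := {t | 0 ≤ t ∧ ENNReal.ofReal t < a}

/-- A Banach space of (classes modulo equality almost everywhere of) functions
`[0, a) → X` that is continuously embedded in `L_{1,loc}([0, a); X)`. It is given by its extended
norm `nrm` on all functions; the elements of the space are the functions of finite norm, and only
the values on `[0, a)` matter. -/
structure BanachFunctionSpace (X : Type*) [NormedAddCommGroup X] [NormedSpace ℝ X]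
    (a : ℝ≥0∞) where
  nrm : (ℝ → X) → ℝ≥0∞
  congr_ae : ∀ f g : ℝ → X, f =ᵐ[volume.restrict (timeInterval a)] g → nrm f = nrm g
  nrm_zero : nrm (fun _ => 0) = 0
  ae_zero : ∀ f, nrm f = 0 → f =ᵐ[volume.restrict (timeInterval a)] fun _ => 0
  smul : ∀ (c : ℝ) (f : ℝ → X), nrm (fun t => c • f t) = ‖c‖ₑ * nrm f
  add_le : ∀ f g : ℝ → X, nrm (fun t => f t + g t) ≤ nrm f + nrm g
  measurable : ∀ f, nrm f < ∞ → AEStronglyMeasurable f (volume.restrict (timeInterval a))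
  embed : ∀ T : ℝ, ENNReal.ofReal T < a → ∃ C : ℝ≥0, ∀ f, nrm f < ∞ →
    ∫⁻ t in Icc 0 T, ‖f t‖ₑ ≤ C * nrm f
  complete : ∀ f : ℕ → ℝ → X, (∀ n, nrm (f n) < ∞) →
    (∀ ε : ℝ≥0∞, 0 < ε → ∃ N, ∀ p ≥ N, ∀ q ≥ N, nrm (fun t => f p t - f q t) ≤ ε) →
    ∃ g, nrm g < ∞ ∧ Tendsto (fun n => nrm (fun t => f n t - g t)) atTop (𝓝 0)

section

variable {X0 X1 : Type*} [NormedAddCommGroup X0] [NormedSpace ℝ X0]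
  [NormedAddCommGroup X1] [NormedSpace ℝ X1]

/-- The function `w : [0, a) → X₁` (defined almost everywhere) belongs to
`H¹_{1,loc}([0, a); X₀)`, its continuous representative with values in `X₀` is `W`, and its weak
derivative is `h ∈ L_{1,loc}([0, a); X₀)`. In particular, `W 0` is the trace of `w` at time `0`. -/
structure HasWeakDeriv (ι : X1 →L[ℝ] X0) (a : ℝ≥0∞) (w : ℝ → X1) (W h : ℝ → X0) : Prop where
  locInt : ∀ T : ℝ, 0 ≤ T → ENNReal.ofReal T < a → IntegrableOn h (Icc 0 T) volume
  rep : ∀ t ∈ timeInterval a, W t = W 0 + ∫ s in (0 : ℝ)..t, h s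
  ae_eq : ∀ᵐ t ∂(volume.restrict (timeInterval a)), ι (w t) = W t

/-- A family of pairs of Banach function spaces `(𝔼₀([0,a)), 𝔼₁([0,a)))`, `a ∈ (0, ∞]`, with
`𝔼₀(J) ↪ L_{1,loc}(J; X₀)` and `𝔼₁(J) ↪ H¹_{1,loc}(J; X₀) ∩ L_{1,loc}(J; X₁)`.
The spaces `𝔼₁(J)` for different `J` belong to one and the same kind of regularity: they are
compatible with restriction, with translation in time, and with the gluing of functions that
overlap on an interval of positive length; and for bounded `J` they contain the
constant functions with values in `X₁`. A compact interval `[0, T]` is treated as `[0, T)`. -/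
structure FunctionSpacePair (ι : X1 →L[ℝ] X0) where
  E0 : ∀ a : ℝ≥0∞, BanachFunctionSpace X0 a
  E1 : ∀ a : ℝ≥0∞, BanachFunctionSpace X1 a
  weakDeriv : ∀ (a : ℝ≥0∞) (w : ℝ → X1), (E1 a).nrm w < ∞ → ∃ W h, HasWeakDeriv ι a w W h
  weakDeriv_embed : ∀ (a : ℝ≥0∞) (T : ℝ), ENNReal.ofReal T < a → ∃ C : ℝ≥0,
    ∀ w W h, (E1 a).nrm w < ∞ → HasWeakDeriv ι a w W h →
      ∫⁻ t in Icc 0 T, ‖h t‖ₑ ≤ C * (E1 a).nrm w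
  restrict : ∀ (a b : ℝ≥0∞), a ≤ b → ∀ w, (E1 a).nrm w ≤ (E1 b).nrm w
  translate : ∀ (s T : ℝ), 0 ≤ s → s < T → ∀ w, (E1 (ENNReal.ofReal T)).nrm w < ∞ →
    (E1 (ENNReal.ofReal (T - s))).nrm (fun t => w (t + s)) < ∞
  glue : ∀ (s s' T : ℝ), 0 ≤ s → s < s' → s' ≤ s + T → ∀ w,
    (E1 (ENNReal.ofReal s')).nrm w < ∞ →
    (E1 (ENNReal.ofReal T)).nrm (fun t => w (t + s)) < ∞ →
    (E1 (ENNReal.ofReal (s + T))).nrm w < ∞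
  const : ∀ T : ℝ, ∃ C : ℝ≥0, ∀ x : X1, (E1 (ENNReal.ofReal T)).nrm (fun _ => x) ≤ C * ‖x‖ₑ

variable {ι : X1 →L[ℝ] X0}

/-- The norm of the trace space `γ𝔼₁(J)`, `J = [0, a)`: the quotient norm
`inf {‖w‖_{𝔼₁(J)} : w ∈ 𝔼₁(J), w(0) = x}`; it is `∞` when `x` is not in the trace space. -/
def traceNorm (E : FunctionSpacePair ι) (a : ℝ≥0∞) (x : X0) : ℝ≥0∞ :=
  ⨅ (w : ℝ → X1) (W : ℝ → X0) (h : ℝ → X0) (_ : HasWeakDeriv ι a w W h) (_ : W 0 = x),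
    (E.E1 a).nrm w

/-- The norm of `X_γ = γ𝔼₁`, where `J = [0, ∞)` is the interval of reference;
`x ∈ X_γ` means `gammaNorm E x < ∞`. -/
def gammaNorm (E : FunctionSpacePair ι) (x : X0) : ℝ≥0∞ := traceNorm E ∞ x

/-- `γ𝔼₁(J)` does not depend on `J`, up to equivalent norms; `𝔼₁(J) ↪ BUC(J; X_γ)`; and the norm
of this embedding on the functions with trace zero is bounded uniformly in `J`. -/
structure CondA1 (E : FunctionSpacePair ι) : Prop where
  indep : ∀ a : ℝ≥0∞, a ≠ 0 → ∃ C : ℝ≥0, ∀ x : X0,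
    traceNorm E a x ≤ C * gammaNorm E x ∧ gammaNorm E x ≤ C * traceNorm E a x
  bounded : ∀ a : ℝ≥0∞, a ≠ 0 → ∃ C : ℝ≥0, ∀ w W h, (E.E1 a).nrm w < ∞ →
    HasWeakDeriv ι a w W h → ∀ t ∈ timeInterval a, gammaNorm E (W t) ≤ C * (E.E1 a).nrm w
  unifCont : ∀ a : ℝ≥0∞, a ≠ 0 → ∀ w W h, (E.E1 a).nrm w < ∞ → HasWeakDeriv ι a w W h →
    ∀ ε : ℝ, 0 < ε → ∃ δ : ℝ, 0 < δ ∧ ∀ s ∈ timeInterval a, ∀ t ∈ timeInterval a,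
      |t - s| < δ → gammaNorm E (W t - W s) ≤ ENNReal.ofReal ε
  trace_zero : ∃ c₀ : ℝ≥0, ∀ a : ℝ≥0∞, a ≠ 0 → ∀ w W h, (E.E1 a).nrm w < ∞ →
    HasWeakDeriv ι a w W h → W 0 = 0 →
    ∀ t ∈ timeInterval a, gammaNorm E (W t) ≤ c₀ * (E.E1 a).nrm w

/-- The comparison of the norms of `𝔼₀(J)` and `𝔼₁(J)`, and the weighted integral estimates. -/
structure CondA2 (E : FunctionSpacePair ι) (ω : ℝ) : Prop where
  domination : ∀ a : ℝ≥0∞, a ≠ 0 → ∀ (w : ℝ → X0) (w' : ℝ → X1),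
    (E.E0 a).nrm w < ∞ → (E.E1 a).nrm w' < ∞ →
    (∀ᵐ t ∂(volume.restrict (timeInterval a)), ‖w t‖ ≤ ‖w' t‖) →
    (E.E0 a).nrm w ≤ (E.E1 a).nrm w'
  integral : ∃ c₁ : ℝ≥0,
    (∀ a : ℝ≥0∞, a ≠ 0 → ∀ w : ℝ → X1, (E.E1 a).nrm w < ∞ →
      ∫⁻ s in timeInterval a, ENNReal.ofReal (Real.exp (-ω * s)) * ‖w s‖ₑ
        ≤ c₁ * (E.E1 a).nrm w) ∧
    (∀ w : ℝ → X1, (E.E1 ∞).nrm w < ∞ → ∀ t : ℝ, 0 ≤ t →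
      ∫⁻ s in Ioi t, ENNReal.ofReal (Real.exp (-ω * s)) * ‖w s‖ₑ
        ≤ c₁ * ENNReal.ofReal (Real.exp (-ω * t)) * (E.E1 ∞).nrm w)

/-- `(𝔼₀(I), 𝔼₁(I))` is a pair of maximal regularity for `A` on bounded intervals:
`w ↦ (w' + A w, w(0))` maps `𝔼₁(I)` into `𝔼₀(I) × γ𝔼₁(I)`, and it does so bijectively. -/
structure CondA3 (E : FunctionSpacePair ι) (A : X1 →L[ℝ] X0) : Prop where
  maps : ∀ T : ℝ, 0 < T → ∀ w W h, (E.E1 (ENNReal.ofReal T)).nrm w < ∞ →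
    HasWeakDeriv ι (ENNReal.ofReal T) w W h →
    (E.E0 (ENNReal.ofReal T)).nrm (fun t => h t + A (w t)) < ∞
  solve : ∀ T : ℝ, 0 < T → ∀ (g : ℝ → X0) (w₀ : X0),
    (E.E0 (ENNReal.ofReal T)).nrm g < ∞ → traceNorm E (ENNReal.ofReal T) w₀ < ∞ →
    ∃ w W, (E.E1 (ENNReal.ofReal T)).nrm w < ∞ ∧
      HasWeakDeriv ι (ENNReal.ofReal T) w W (fun t => g t - A (w t)) ∧ W 0 = w₀ ∧
      ∀ w' W', (E.E1 (ENNReal.ofReal T)).nrm w' < ∞ →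
        HasWeakDeriv ι (ENNReal.ofReal T) w' W' (fun t => g t - A (w' t)) → W' 0 = w₀ →
        w' =ᵐ[volume.restrict (timeInterval (ENNReal.ofReal T))] w

/-- The sector `{z ≠ 0 : |arg z| < θ}`. -/
def sector (θ : ℝ) : Set ℂ := {z | z ≠ 0 ∧ |z.arg| < θ}

/-- `-A`, as an operator in the real Banach space `X₀` with domain `X₁`, generates the strongly
continuous analytic semigroup `S t = e^{-tA}`. Analyticity: on the complexification `X₀ ⊕ i X₀`,
the semigroup extends to a holomorphic family `C z + i D z`, with `C z` and `D z` real operators,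
on a sector, which is a semigroup there and strongly continuous at `0`; `holo` says that this
family has the complex derivative `P + i Q` at `z`. -/
structure GeneratesAnalytic (ι A : X1 →L[ℝ] X0) (S : ℝ → X0 →L[ℝ] X0) : Prop where
  zero : S 0 = ContinuousLinearMap.id ℝ X0
  add : ∀ s t : ℝ, 0 ≤ s → 0 ≤ t → S (s + t) = (S s).comp (S t)
  cont : ∀ x : X0, ContinuousOn (fun t => S t x) (Ici 0)
  generator : ∀ x y : X0,
    Tendsto (fun t : ℝ => t⁻¹ • (S t x - x)) (𝓝[>] 0) (𝓝 y) ↔ ∃ z : X1, ι z = x ∧ -(A z) = y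
  analytic : ∃ θ : ℝ, 0 < θ ∧ θ ≤ Real.pi / 2 ∧ ∃ C D : ℂ → X0 →L[ℝ] X0,
    (∀ t : ℝ, 0 < t → C t = S t ∧ D t = 0) ∧
    (∀ z ∈ sector θ, ∀ z' ∈ sector θ,
      C (z + z') = (C z).comp (C z') - (D z).comp (D z') ∧
      D (z + z') = (C z).comp (D z') + (D z).comp (C z')) ∧
    (∀ z ∈ sector θ, ∃ P Q : X0 →L[ℝ] X0,
      HasFDerivAt C (Complex.reCLM.smulRight P - Complex.imCLM.smulRight Q) z ∧
      HasFDerivAt D (Complex.reCLM.smulRight Q + Complex.imCLM.smulRight P) z) ∧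
    (∀ x : X0, Tendsto (fun z => C z x) (𝓝[sector θ] 0) (𝓝 x) ∧
      Tendsto (fun z => D z x) (𝓝[sector θ] 0) (𝓝 0))

/-- The operator `z - A` from `X₁ ⊕ i X₁` to `X₀ ⊕ i X₀`, for complex `z`. -/
def complexShift (ι A : X1 →L[ℝ] X0) (z : ℂ) (p : X1 × X1) : X0 × X0 :=
  (z.re • ι p.1 - z.im • ι p.2 - A p.1, z.im • ι p.1 + z.re • ι p.2 - A p.2)

/-- The spectrum of (the complexification of) the operator `A` in `X₀` with domain `X₁`. -/
def complexSpectrum (ι A : X1 →L[ℝ] X0) : Set ℂ :=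
  {z | ¬ Function.Bijective (complexShift ι A z)}

/-- The kernel `N(A)`, as a subspace of `X₀`. -/
def kerSpace (ι A : X1 →L[ℝ] X0) : Submodule ℝ X0 :=
  (LinearMap.ker (A : X1 →ₗ[ℝ] X0)).map (ι : X1 →ₗ[ℝ] X0)

/-- The range `R(A)`. -/
def rangeSpace (A : X1 →L[ℝ] X0) : Submodule ℝ X0 := LinearMap.range (A : X1 →ₗ[ℝ] X0)

/-- When `0` is semi-simple, i.e. `N(A) ⊕ R(A) = X₀`, the spectral projection `P_s` belonging to
`σ(A) \ {0}` is the projection onto `R(A)` along `N(A)`. -/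
def stableProj (ι A : X1 →L[ℝ] X0) (h : IsCompl (kerSpace ι A) (rangeSpace A)) : X0 →ₗ[ℝ] X0 :=
  (rangeSpace A).projection (kerSpace ι A) h.symm

/-- Maximal regularity of the part `A_s` of `A` in `P_s X₀`, with exponential weights and
with constants uniform in `J`. The semigroup `e^{-A_s t}` is the restriction to `P_s X₀` of
`S t = e^{-A t}`. -/
structure CondA4 (E : FunctionSpacePair ι) (A : X1 →L[ℝ] X0) (S : ℝ → X0 →L[ℝ] X0)
    (hA : IsCompl (kerSpace ι A) (rangeSpace A)) (ω : ℝ) : Prop where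
  /-- `P_s` acts in `𝔼₀(J)`. -/
  proj_mem : ∀ a : ℝ≥0∞, a ≠ 0 → ∀ g : ℝ → X0, (E.E0 a).nrm g < ∞ →
    (E.E0 a).nrm (fun t => stableProj ι A hA (g t)) < ∞
  solve : ∃ M₀ : ℝ≥0, ∀ a : ℝ≥0∞, a ≠ 0 → ∀ σ ∈ Icc 0 ω, ∀ g : ℝ → X0,
    (E.E0 a).nrm (fun t => Real.exp (σ * t) • stableProj ι A hA (g t)) < ∞ →
    ∃ w W, (∀ᵐ t ∂(volume.restrict (timeInterval a)), ι (w t) ∈ rangeSpace A) ∧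
      HasWeakDeriv ι a w W (fun t => stableProj ι A hA (g t) - A (w t)) ∧ W 0 = 0 ∧
      (E.E1 a).nrm (fun t => Real.exp (σ * t) • w t)
        ≤ M₀ * (E.E0 a).nrm (fun t => Real.exp (σ * t) • stableProj ι A hA (g t)) ∧
      ∀ w' W', (∀ᵐ t ∂(volume.restrict (timeInterval a)), ι (w' t) ∈ rangeSpace A) →
        HasWeakDeriv ι a w' W' (fun t => stableProj ι A hA (g t) - A (w' t)) → W' 0 = 0 →
        (E.E1 a).nrm (fun t => Real.exp (σ * t) • w' t) < ∞ →
        w' =ᵐ[volume.restrict (timeInterval a)] w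
  semigroup : ∃ M₁ : ℝ≥0, ∀ a : ℝ≥0∞, a ≠ 0 → ∀ σ ∈ Icc 0 ω, ∀ z : X0, gammaNorm E z < ∞ →
    ∃ w : ℝ → X1, (∀ t : ℝ, 0 < t → ι (w t) = S t (stableProj ι A hA z)) ∧
      (E.E1 a).nrm (fun t => Real.exp (σ * t) • w t) +
        ⨆ t ∈ timeInterval a, gammaNorm E (Real.exp (σ * t) • S t (stableProj ι A hA z))
        ≤ M₁ * gammaNorm E (stableProj ι A hA z)

/-- The nonlinearity `G(z) = F'(u⁎) z - F(z + u⁎)`, for `z ∈ U₁ - u⁎`. -/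
def nonlin (F : X1 → X0) (u : X1) (z : X1) : X0 := fderiv ℝ F u z - F (z + u)

/-- The structure condition on `G`. -/
def CondA5 (E : FunctionSpacePair ι) (F : X1 → X0) (U₁ : Set X1) (u : X1) : Prop :=
  ∃ C₁ : ℝ, ∀ η : ℝ, 0 < η → ∃ r : ℝ, 0 < r ∧ ∀ z₁ z₂ : X1, z₁ + u ∈ U₁ → z₂ + u ∈ U₁ →
    gammaNorm E (ι z₁) < ENNReal.ofReal r → gammaNorm E (ι z₂) < ENNReal.ofReal r →
    ‖nonlin F u z₁ - nonlin F u z₂‖ ≤ C₁ * (η + ‖z₂‖) * ‖z₁ - z₂‖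

/-- `v ∈ 𝔼₁([0, a))` solves `v' + A v = G(v)`, `v(0) = v₀`; `V` is its continuous
representative. -/
structure SolvesShifted (E : FunctionSpacePair ι) (F : X1 → X0) (U₁ : Set X1) (u : X1)
    (a : ℝ≥0∞) (v₀ : X0) (v : ℝ → X1) (V : ℝ → X0) : Prop where
  mem : (E.E1 a).nrm v < ∞
  dom : ∀ᵐ t ∂(volume.restrict (timeInterval a)), v t + u ∈ U₁
  eqn : HasWeakDeriv ι a v V (fun t => nonlin F u (v t) - fderiv ℝ F u (v t))
  init : V 0 = v₀

/-- Solvability of `v' + A v = G(v)`, `v(0) = v₀`, in `𝔼₁([0, b])` for small `v₀`. -/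
def CondA6 (E : FunctionSpacePair ι) (F : X1 → X0) (U₁ : Set X1) (u : X1) : Prop :=
  ∀ b : ℝ, 0 < b → ∃ r₂ : ℝ, 0 < r₂ ∧ ∀ v₀ : X0, gammaNorm E v₀ < ENNReal.ofReal r₂ →
    ∃ v V, SolvesShifted E F U₁ u (ENNReal.ofReal b) v₀ v V ∧
      ∀ v' V', SolvesShifted E F U₁ u (ENNReal.ofReal b) v₀ v' V' →
        v' =ᵐ[volume.restrict (timeInterval (ENNReal.ofReal b))] v

/-- `u : ℝ₊ → X₀` is a solution on `[0, ∞)` of `u' + F(u) = 0`, `u(0) = u₀`, in the class of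
functions that belong to `𝔼₁([0, T))` for all finite `T`; here `w` is `u`, seen as a function with
values in `X₁` almost everywhere. -/
def IsGlobalSolution (E : FunctionSpacePair ι) (F : X1 → X0) (U₁ : Set X1) (u₀ : X0)
    (u : ℝ → X0) : Prop :=
  u 0 = u₀ ∧ ∃ w : ℝ → X1, ∀ T : ℝ, 0 < T →
    (E.E1 (ENNReal.ofReal T)).nrm w < ∞ ∧
    (∀ᵐ t ∂(volume.restrict (timeInterval (ENNReal.ofReal T))), w t ∈ U₁) ∧
    HasWeakDeriv ι (ENNReal.ofReal T) w u (fun t => -F (w t))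

/-- Near the equilibrium `u`, the equilibria of `u' + F(u) = 0` form an `m`-dimensional
`C¹`-manifold in `X₁`, parametrized by `Ψ` on the open set `U ⊆ ℝᵐ`. -/
structure IsEquilibriumManifold (F : X1 → X0) (U₁ : Set X1) (u : X1) (m : ℕ)
    (U : Set (EuclideanSpace ℝ (Fin m))) (Ψ : EuclideanSpace ℝ (Fin m) → X1) : Prop where
  isOpen : IsOpen U
  zero_mem : (0 : EuclideanSpace ℝ (Fin m)) ∈ U
  smooth : ContDiffOn ℝ 1 Ψ U
  base : Ψ 0 = u
  equilibria : ∀ ζ ∈ U, Ψ ζ ∈ U₁ ∧ F (Ψ ζ) = 0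
  rank : Module.finrank ℝ
    (LinearMap.range (fderiv ℝ Ψ 0 : EuclideanSpace ℝ (Fin m) →ₗ[ℝ] X1)) = m
  only : ∃ r₁ : ℝ, 0 < r₁ ∧ {x | x ∈ U₁ ∧ F x = 0} ∩ Metric.ball u r₁ = Ψ '' U

end

end MaxReg

end

/-!
The proof follows the solution from one multiple of a fixed time `T` to the next. Let `κ` be the
spectral projection onto `N(A)`. Because the equilibria form a manifold tangent to `N(A)`, every
small `x` shares its component in `N(A)` with an equilibrium `Φ x` that depends on this component in
a Lipschitz way (`IsEquilibriumManifold.exists_graph`, by the inverse function theorem). All equations are shifted,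
so that `0` is the given equilibrium.

Let `v` be a solution with small initial value `v₀`, and put `e = Φ v₀`. The difference `w = v - e`
solves `w' + A w = g` with `g = G(v) - G(e)`, where `|g|₀ ≤ β |w|₁` with a small `β` by the structure
condition on `G`, and `w(0)` lies in `R(A)`. Maximal regularity then shows that `w(t)` differs from
`e^{-tA} w(0)` by at most `C β |w(0)|_γ` (`exists_dist_semigroup_le`). The point is that `C` does not
depend on the length of the time interval, as long as this is bounded: only the part of `w` in
`R(A)` is estimated in `𝔼₁`, while its part in the kernel is bounded in the supremum norm and enters
the norm of `𝔼₁` through a constant function. This uniformity allows a continuation argument, by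
which `v` stays small on `[0, 2T)`. Since `e^{-tA}` decays on `R(A)`, for suitable `T` the distance of
`v(T)` to its equilibrium `Φ(v(T))` is at most half the distance of `v₀` to `Φ v₀`, and the
equilibrium moves by at most a multiple of this distance (`exists_isContractiveStep`).

Iteration gives a global solution, by gluing the pieces on `[nT, (n+2)T)`, which agree on their
overlaps by local uniqueness. The equilibria `Φ(v(nT))` converge geometrically, and so does `v`
(`IsContractiveStep.exists_stable`).

The identification of the part of `w` in `R(A)` with the sum of the solution given by maximal
regularity and a semigroup orbit needs uniqueness in the class of weakly differentiable functions.
This is `HasWeakDeriv.eq_semigroup`, by differentiating `s ↦ e^{-(t-s)A} ∫₀ˢ q`.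
-/

namespace MaxReg

/-! ### Time intervals -/

theorem timeInterval_ofReal (T : ℝ) : timeInterval (ENNReal.ofReal T) = Ico 0 T := by
  ext t
  simp only [timeInterval, mem_ofPred_eq, mem_Ico]
  refine and_congr_right fun ht => ?_
  rw [ENNReal.ofReal_lt_ofReal_iff']
  exact ⟨fun h => h.1, fun h => ⟨h, ht.trans_lt h⟩⟩

theorem timeInterval_top : timeInterval ∞ = Ici 0 := by
  ext t; simp [timeInterval]

theorem timeInterval_mono {a b : ℝ≥0∞} (h : a ≤ b) : timeInterval a ⊆ timeInterval b :=
  fun _ ht => ⟨ht.1, ht.2.trans_le h⟩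

theorem ordConnected_timeInterval (a : ℝ≥0∞) : (timeInterval a).OrdConnected :=
  ⟨fun _ hs _ ht _ hx =>
    ⟨hs.1.trans hx.1, (ENNReal.ofReal_le_ofReal hx.2).trans_lt ht.2⟩⟩

theorem measurableSet_timeInterval (a : ℝ≥0∞) : MeasurableSet (timeInterval a) :=
  (ordConnected_timeInterval a).measurableSet

theorem Icc_subset_timeInterval {a : ℝ≥0∞} {t : ℝ} (ht : t ∈ timeInterval a) :
    Icc 0 t ⊆ timeInterval a :=
  fun _ hs => ⟨hs.1, (ENNReal.ofReal_le_ofReal hs.2).trans_lt ht.2⟩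

theorem ae_Ioc_of_ae_timeInterval {a : ℝ≥0∞} {t : ℝ} (ht : t ∈ timeInterval a) {p : ℝ → Prop}
    (h : ∀ᵐ s ∂(volume.restrict (timeInterval a)), p s) : ∀ᵐ s, s ∈ Ioc 0 t → p s := by
  rw [← ae_restrict_iff' measurableSet_Ioc]
  exact ae_restrict_of_ae_restrict_of_subset
    (Ioc_subset_Icc_self.trans (Icc_subset_timeInterval ht)) h

/-- Translation of almost everywhere statements between intervals of the time axis. -/
theorem ae_comp_add_right {s : Set ℝ} {c : ℝ} {p : ℝ → Prop}
    (h : ∀ᵐ t ∂(volume.restrict s), p t) :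
    ∀ᵐ t ∂(volume.restrict ((fun t => t + c) ⁻¹' s)), p (t + c) :=
  ((measurePreserving_add_right volume c).restrict_preimage_emb
    (measurableEmbedding_addRight c) s).quasiMeasurePreserving.ae h

/-! ### Weak derivatives -/

section

variable {X0 X1 : Type*} [NormedAddCommGroup X0] [NormedSpace ℝ X0]
  [NormedAddCommGroup X1] [NormedSpace ℝ X1] {ι : X1 →L[ℝ] X0}

namespace HasWeakDeriv

variable {a b : ℝ≥0∞} {w w' : ℝ → X1} {W W' h h' : ℝ → X0}

theorem intervalIntegrable (H : HasWeakDeriv ι a w W h) {t : ℝ} (ht : t ∈ timeInterval a) :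
    IntervalIntegrable h volume 0 t := by
  rw [intervalIntegrable_iff_integrableOn_Icc_of_le ht.1]
  exact H.locInt t ht.1 ht.2

theorem mono (H : HasWeakDeriv ι b w W h) (hab : a ≤ b) : HasWeakDeriv ι a w W h where
  locInt T h0 hT := H.locInt T h0 (hT.trans_le hab)
  rep t ht := H.rep t (timeInterval_mono hab ht)
  ae_eq := ae_restrict_of_ae_restrict_of_subset (timeInterval_mono hab) H.ae_eq

theorem add (H : HasWeakDeriv ι a w W h) (H' : HasWeakDeriv ι a w' W' h') :
    HasWeakDeriv ι a (fun t => w t + w' t) (fun t => W t + W' t) (fun t => h t + h' t) where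
  locInt T h0 hT := (H.locInt T h0 hT).add (H'.locInt T h0 hT)
  rep t ht := by
    rw [intervalIntegral.integral_add (H.intervalIntegrable ht) (H'.intervalIntegrable ht),
      H.rep t ht, H'.rep t ht]
    abel
  ae_eq := by
    filter_upwards [H.ae_eq, H'.ae_eq] with t h1 h2
    rw [map_add, h1, h2]

theorem const_smul (H : HasWeakDeriv ι a w W h) (c : ℝ) :
    HasWeakDeriv ι a (fun t => c • w t) (fun t => c • W t) (fun t => c • h t) where
  locInt T h0 hT := (H.locInt T h0 hT).smul c
  rep t ht := by
    rw [intervalIntegral.integral_smul, H.rep t ht, smul_add]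
  ae_eq := by
    filter_upwards [H.ae_eq] with t h1
    rw [map_smul, h1]

theorem sub (H : HasWeakDeriv ι a w W h) (H' : HasWeakDeriv ι a w' W' h') :
    HasWeakDeriv ι a (fun t => w t - w' t) (fun t => W t - W' t) (fun t => h t - h' t) := by
  simpa [sub_eq_add_neg] using H.add (H'.const_smul (-1))

theorem const (x : X1) : HasWeakDeriv ι a (fun _ => x) (fun _ => ι x) (fun _ => 0) where
  locInt T _ _ := integrableOn_zero
  rep t _ := by simp
  ae_eq := by simp

theorem map [CompleteSpace X0] (H : HasWeakDeriv ι a w W h) {L₁ : X1 →L[ℝ] X1} {L₀ : X0 →L[ℝ] X0}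
    (hL : ∀ x, ι (L₁ x) = L₀ (ι x)) :
    HasWeakDeriv ι a (fun t => L₁ (w t)) (fun t => L₀ (W t)) (fun t => L₀ (h t)) where
  locInt T h0 hT := L₀.integrable_comp (H.locInt T h0 hT)
  rep t ht := by
    rw [L₀.intervalIntegral_comp_comm (H.intervalIntegrable ht), H.rep t ht, map_add]
  ae_eq := by
    filter_upwards [H.ae_eq] with t h1
    rw [hL, h1]

theorem continuousOn (H : HasWeakDeriv ι a w W h) : ContinuousOn W (timeInterval a) := by
  intro t ht
  -- pass to a compact interval `[0, t']` that is a neighbourhood of `t` within `[0, a)`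
  obtain ⟨c, hc1, hc2⟩ := exists_between ht.2
  have hct : c ≠ ∞ := (hc2.trans_le le_top).ne
  have htc : t < c.toReal := (ENNReal.ofReal_lt_iff_lt_toReal ht.1 hct).1 hc1
  have hc : c.toReal ∈ timeInterval a := ⟨ENNReal.toReal_nonneg, by rwa [ENNReal.ofReal_toReal hct]⟩
  have hcont : ContinuousOn W (Icc 0 c.toReal) := by
    have : ContinuousOn (fun t => W 0 + ∫ s in (0 : ℝ)..t, h s) (Icc 0 c.toReal) := by
      refine continuousOn_const.add ?_
      have := intervalIntegral.continuousOn_primitive_interval' (H.intervalIntegrable hc)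
        (left_mem_uIcc)
      rwa [uIcc_of_le hc.1] at this
    exact this.congr fun s hs => H.rep s (Icc_subset_timeInterval hc hs)
  refine (hcont t ⟨ht.1, htc.le⟩).mono_of_mem_nhdsWithin ?_
  filter_upwards [self_mem_nhdsWithin, mem_nhdsWithin_of_mem_nhds (Iio_mem_nhds htc)] with s h1 h2
  exact ⟨h1.1, le_of_lt h2⟩

theorem congr_ae (H : HasWeakDeriv ι a w W h)
    (hw : w' =ᵐ[volume.restrict (timeInterval a)] w) (hW : EqOn W' W (timeInterval a))
    (hh : h' =ᵐ[volume.restrict (timeInterval a)] h) : HasWeakDeriv ι a w' W' h' where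
  locInt T h0 hT := (H.locInt T h0 hT).congr_fun_ae
    (ae_restrict_of_ae_restrict_of_subset (Icc_subset_timeInterval ⟨h0, hT⟩) hh.symm)
  rep t ht := by
    rw [hW ht, hW ⟨le_rfl, (ENNReal.ofReal_le_ofReal ht.1).trans_lt ht.2⟩, H.rep t ht]
    congr 1
    refine intervalIntegral.integral_congr_ae ?_
    rw [uIoc_of_le ht.1]
    exact ae_Ioc_of_ae_timeInterval ht hh.symm
  ae_eq := by
    filter_upwards [hw, H.ae_eq, ae_restrict_mem (measurableSet_timeInterval a)] with t h1 h2 h3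
    rw [h1, h2, hW h3]

/-- The continuous representative is determined by the weak derivative and the trace. -/
theorem eqOn_rep (H : HasWeakDeriv ι a w W h) (H' : HasWeakDeriv ι a w' W' h')
    (h0 : W 0 = W' 0) (hh : h =ᵐ[volume.restrict (timeInterval a)] h') :
    EqOn W W' (timeInterval a) := by
  intro t ht
  rw [H.rep t ht, H'.rep t ht, h0]
  congr 1
  refine intervalIntegral.integral_congr_ae ?_
  rw [uIoc_of_le ht.1]
  exact ae_Ioc_of_ae_timeInterval ht hh

theorem translate {T s : ℝ} (H : HasWeakDeriv ι (ENNReal.ofReal T) w W h) (hs : 0 ≤ s) :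
    HasWeakDeriv ι (ENNReal.ofReal (T - s)) (fun t => w (t + s)) (fun t => W (t + s))
      (fun t => h (t + s)) := by
  have hmem : ∀ t ∈ timeInterval (ENNReal.ofReal (T - s)),
      t + s ∈ timeInterval (ENNReal.ofReal T) := by
    intro t ht
    rw [timeInterval_ofReal] at ht ⊢
    exact ⟨by linarith [ht.1], by linarith [ht.2]⟩
  have hint : ∀ t ∈ timeInterval (ENNReal.ofReal (T - s)),
      IntervalIntegrable h volume s (t + s) := fun t ht =>
    (H.intervalIntegrable (hmem t ht)).mono_set (by
      rw [uIcc_of_le (by linarith [ht.1]), uIcc_of_le (by linarith [ht.1])]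
      exact Icc_subset_Icc_left hs)
  refine ⟨fun t h0 ht => ?_, fun t ht => ?_, ?_⟩
  · have := (hint t ⟨h0, ht⟩).comp_add_right s
    rw [sub_self, add_sub_cancel_right] at this
    rwa [intervalIntegrable_iff_integrableOn_Icc_of_le h0] at this
  · have h1 := H.rep _ (hmem t ht)
    have h0' : (0 : ℝ) ∈ timeInterval (ENNReal.ofReal (T - s)) :=
      ⟨le_rfl, (ENNReal.ofReal_le_ofReal ht.1).trans_lt ht.2⟩
    have h2 := H.rep _ (hmem 0 h0')
    have h3 := intervalIntegral.integral_add_adjacent_intervals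
      (H.intervalIntegrable (hmem 0 h0')) (by simpa using hint t ht)
    simp only [zero_add] at h2 h3 ⊢
    rw [h1, h2, ← h3, intervalIntegral.integral_comp_add_right, zero_add]
    abel
  · refine ae_restrict_of_ae_restrict_of_subset hmem (ae_comp_add_right (c := s) H.ae_eq)

theorem glue {s s' T : ℝ} (hs : 0 ≤ s) (hss : s < s')
    (H : HasWeakDeriv ι (ENNReal.ofReal s') w W h)
    (H' : HasWeakDeriv ι (ENNReal.ofReal T) (fun t => w (t + s)) (fun t => W (t + s))
      (fun t => h (t + s))) :
    HasWeakDeriv ι (ENNReal.ofReal (s + T)) w W h := by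
  have hsmem : s ∈ timeInterval (ENNReal.ofReal s') := by
    rw [timeInterval_ofReal]; exact ⟨hs, hss⟩
  have hmem : ∀ t ∈ timeInterval (ENNReal.ofReal (s + T)), s ≤ t →
      t - s ∈ timeInterval (ENNReal.ofReal T) := by
    intro t ht hst
    rw [timeInterval_ofReal] at ht ⊢
    exact ⟨by linarith, by linarith [ht.2]⟩
  have hint : ∀ t ∈ timeInterval (ENNReal.ofReal (s + T)), s ≤ t →
      IntervalIntegrable h volume s t := by
    intro t ht hst
    have := (H'.intervalIntegrable (hmem t ht hst)).comp_sub_right s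
    simpa using this
  have hint0 : ∀ t ∈ timeInterval (ENNReal.ofReal (s + T)), IntervalIntegrable h volume 0 t := by
    intro t ht
    rcases le_total s t with hst | hst
    · exact (H.intervalIntegrable hsmem).trans (hint t ht hst)
    · exact H.intervalIntegrable (Icc_subset_timeInterval hsmem ⟨ht.1, hst⟩)
  refine ⟨fun t h0 ht => ?_, fun t ht => ?_, ?_⟩
  · exact (intervalIntegrable_iff_integrableOn_Icc_of_le h0).1 (hint0 t ⟨h0, ht⟩)
  · rcases le_total s t with hst | hst
    · have h1 := H'.rep _ (hmem t ht hst)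
      have h3 := intervalIntegral.integral_add_adjacent_intervals
        (H.intervalIntegrable hsmem) (hint t ht hst)
      rw [intervalIntegral.integral_comp_add_right] at h1
      simp only [zero_add, sub_add_cancel] at h1
      rw [h1, H.rep s hsmem, ← h3]
      abel
    · exact H.rep t (Icc_subset_timeInterval hsmem ⟨ht.1, hst⟩)
  · have hsub : timeInterval (ENNReal.ofReal (s + T)) ⊆
        timeInterval (ENNReal.ofReal s') ∪
          (fun t => t + -s) ⁻¹' timeInterval (ENNReal.ofReal T) := by
      intro t ht
      rcases le_total s t with hst | hst
      · right
        simpa [← sub_eq_add_neg] using hmem t ht hst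
      · exact Or.inl (Icc_subset_timeInterval hsmem ⟨ht.1, hst⟩)
    refine ae_restrict_of_ae_restrict_of_subset hsub ?_
    rw [ae_restrict_union_iff]
    refine ⟨H.ae_eq, ?_⟩
    simpa using ae_comp_add_right (c := -s) H'.ae_eq

end HasWeakDeriv

/-! ### The trace norm -/

theorem traceNorm_lt_iff {E : FunctionSpacePair ι} {a : ℝ≥0∞} {x : X0} {b : ℝ≥0∞} :
    traceNorm E a x < b ↔ ∃ w W h, HasWeakDeriv ι a w W h ∧ W 0 = x ∧ (E.E1 a).nrm w < b := by
  simp only [traceNorm, iInf_lt_iff, exists_prop]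

theorem traceNorm_le {E : FunctionSpacePair ι} {a : ℝ≥0∞} {w : ℝ → X1} {W h : ℝ → X0}
    (H : HasWeakDeriv ι a w W h) : traceNorm E a (W 0) ≤ (E.E1 a).nrm w :=
  iInf_le_of_le w <| iInf_le_of_le W <| iInf_le_of_le h <| iInf_le_of_le H <| iInf_le_of_le rfl
    le_rfl

variable (E : FunctionSpacePair ι)

theorem gammaNorm_add_le (x y : X0) : gammaNorm E (x + y) ≤ gammaNorm E x + gammaNorm E y := by
  refine ENNReal.le_of_forall_pos_le_add fun ε hε hfin => ?_
  have hε2 : (ε / 2 : ℝ≥0∞) ≠ 0 := by simpa using hε.ne'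
  have hx := ENNReal.lt_add_right (ENNReal.add_lt_top.1 hfin).1.ne hε2
  have hy := ENNReal.lt_add_right (ENNReal.add_lt_top.1 hfin).2.ne hε2
  obtain ⟨w, W, h, H, rfl, hw⟩ := traceNorm_lt_iff.1 hx
  obtain ⟨w', W', h', H', rfl, hw'⟩ := traceNorm_lt_iff.1 hy
  have hadd := traceNorm_le (E := E) (H.add H')
  calc gammaNorm E (W 0 + W' 0) ≤ (E.E1 ∞).nrm (fun t => w t + w' t) := hadd
    _ ≤ (E.E1 ∞).nrm w + (E.E1 ∞).nrm w' := (E.E1 ∞).add_le _ _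
    _ ≤ (gammaNorm E (W 0) + ε / 2) + (gammaNorm E (W' 0) + ε / 2) := add_le_add hw.le hw'.le
    _ = gammaNorm E (W 0) + gammaNorm E (W' 0) + ε := by
      rw [add_add_add_comm, ENNReal.add_halves]

theorem gammaNorm_smul_le {c : ℝ} (hc : c ≠ 0) (x : X0) :
    gammaNorm E (c • x) ≤ ‖c‖ₑ * gammaNorm E x := by
  have hc0 : ‖c‖ₑ ≠ 0 := by simpa using hc
  have hct : ‖c‖ₑ ≠ ∞ := enorm_ne_top
  rw [mul_comm, ← ENNReal.div_le_iff hc0 hct]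
  refine le_of_forall_gt fun b hb => ?_
  obtain ⟨w, W, h, H, rfl, hw⟩ := traceNorm_lt_iff.1 hb
  rw [ENNReal.div_lt_iff (Or.inl hc0) (Or.inl hct), mul_comm]
  refine (traceNorm_le (H.const_smul c)).trans_lt ?_
  rw [(E.E1 ∞).smul]
  exact ENNReal.mul_lt_mul_right hc0 hct hw

theorem gammaNorm_neg (x : X0) : gammaNorm E (-x) = gammaNorm E x := by
  have h : ∀ y, gammaNorm E (-y) ≤ gammaNorm E y := fun y => by
    simpa using gammaNorm_smul_le E (c := -1) (by norm_num) y
  exact le_antisymm (h x) (by simpa using h (-x))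

theorem gammaNorm_sub_le (x y : X0) : gammaNorm E (x - y) ≤ gammaNorm E x + gammaNorm E y := by
  rw [sub_eq_add_neg, ← gammaNorm_neg E y]
  exact gammaNorm_add_le E _ _

/-- The domain `X₁` embeds into the trace space. -/
theorem exists_gammaNorm_le (h1 : CondA1 E) :
    ∃ C : ℝ≥0, ∀ x : X1, gammaNorm E (ι x) ≤ C * ‖x‖ₑ := by
  obtain ⟨C, hC⟩ := E.const 1
  obtain ⟨C', hC'⟩ := h1.indep (ENNReal.ofReal 1) (by simp)
  refine ⟨C' * C, fun x => (hC' _).2.trans ?_⟩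
  rw [ENNReal.coe_mul, mul_assoc]
  gcongr
  exact (traceNorm_le (HasWeakDeriv.const x)).trans (hC x)

/-- The trace space embeds into `X₀`. -/
theorem exists_enorm_le_gammaNorm :
    ∃ C : ℝ≥0, ∀ x : X0, ‖x‖ₑ ≤ C * gammaNorm E x := by
  obtain ⟨C, hC⟩ := E.weakDeriv_embed ∞ 1 (by simp)
  obtain ⟨C', hC'⟩ := (E.E1 ∞).embed 1 (by simp)
  set D : ℝ≥0 := ‖ι‖₊ * C' + C with hD
  have key : ∀ x : X0, ∀ b, gammaNorm E x < b → ‖x‖ₑ ≤ D * b := by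
    intro x b hb
    obtain ⟨w, W, h, H, rfl, hw⟩ := traceNorm_lt_iff.1 hb
    have hfin : (E.E1 ∞).nrm w < ∞ := hw.trans_le le_top
    have hsub : Icc (0 : ℝ) 1 ⊆ timeInterval ∞ := by
      rw [timeInterval_top]; exact Icc_subset_Ici_self
    -- `‖W 0‖` is bounded by its mean over `[0, 1]`, up to the integral of the weak derivative
    have hpt : ∀ᵐ t ∂(volume.restrict (Icc (0 : ℝ) 1)),
        ‖W 0‖ₑ ≤ ‖ι‖ₑ * ‖w t‖ₑ + ∫⁻ s in Icc 0 1, ‖h s‖ₑ := by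
      filter_upwards [ae_restrict_of_ae_restrict_of_subset hsub H.ae_eq,
        ae_restrict_mem measurableSet_Icc] with t ht1 ht2
      have e : W 0 = ι (w t) - ∫ s in (0 : ℝ)..t, h s := by
        rw [ht1, H.rep t (hsub ht2), add_sub_cancel_right]
      rw [e]
      refine (enorm_sub_le).trans (add_le_add (ι.le_opENorm _) ?_)
      rw [intervalIntegral.integral_of_le ht2.1]
      exact (enorm_integral_le_lintegral_enorm _).trans
        (lintegral_mono_set (fun s hs => ⟨hs.1.le, hs.2.trans ht2.2⟩))
    have := lintegral_mono_ae hpt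
    have hmeas : AEMeasurable (fun t => ‖w t‖ₑ) (volume.restrict (Icc (0 : ℝ) 1)) :=
      (((E.E1 ∞).measurable w hfin).mono_measure (Measure.restrict_mono_set _ hsub)).enorm
    rw [lintegral_add_right _ measurable_const, lintegral_const_mul'' _ hmeas] at this
    simp only [lintegral_const, Measure.restrict_apply MeasurableSet.univ, univ_inter,
      Real.volume_Icc, sub_zero, ENNReal.ofReal_one, mul_one] at this
    refine this.trans ?_
    calc (‖ι‖ₑ * ∫⁻ t in Icc 0 1, ‖w t‖ₑ) + ∫⁻ s in Icc 0 1, ‖h s‖ₑ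
        ≤ ‖ι‖ₑ * (C' * (E.E1 ∞).nrm w) + C * (E.E1 ∞).nrm w := by
          gcongr
          · exact hC' w hfin
          · exact hC w W h hfin H
      _ = D * (E.E1 ∞).nrm w := by
          rw [hD]; push_cast; rw [enorm_eq_nnnorm]; ring
      _ ≤ D * b := by gcongr
  refine ⟨D + 1, fun x => ?_⟩
  rcases eq_or_ne (gammaNorm E x) ∞ with h | h
  · simp [h]
  · refine le_trans (b := (D : ℝ≥0∞) * gammaNorm E x) ?_ (by gcongr; simp)
    rcases eq_or_ne D 0 with h0 | h0
    · simpa [h0] using key x _ (ENNReal.lt_add_right h one_ne_zero)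
    · rw [mul_comm, ← ENNReal.div_le_iff (by simpa using h0) ENNReal.coe_ne_top]
      refine le_of_forall_gt_imp_ge_of_dense fun b hb => ?_
      rw [ENNReal.div_le_iff (by simpa using h0) ENNReal.coe_ne_top, mul_comm]
      exact key x b hb

end

section

variable {X0 X1 : Type*} [NormedAddCommGroup X0] [NormedSpace ℝ X0]
  [NormedAddCommGroup X1] [NormedSpace ℝ X1] {ι A : X1 →L[ℝ] X0}

/-! ### Uniqueness of solutions of the linear equation -/

namespace GeneratesAnalytic

variable {S : ℝ → X0 →L[ℝ] X0}

/-- Joint continuity of `(s, x) ↦ e^{-sA} x`. -/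
theorem tendsto_apply [CompleteSpace X0] (hS : GeneratesAnalytic ι A S) {α : Type*} {l : Filter α}
    {r : α → ℝ} {r₀ : ℝ} {x : α → X0} {x₀ : X0} (hr : Tendsto r l (𝓝 r₀))
    (hr0 : ∀ᶠ i in l, 0 ≤ r i) (hr₀ : 0 ≤ r₀) (hx : Tendsto x l (𝓝 x₀)) :
    Tendsto (fun i => S (r i) (x i)) l (𝓝 (S r₀ x₀)) := by
  obtain ⟨M, hM⟩ : ∃ M, ∀ s : Icc (0 : ℝ) (r₀ + 1), ‖S s‖ ≤ M := by
    refine banach_steinhaus fun y => ?_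
    obtain ⟨C, hC⟩ := isCompact_Icc.exists_bound_of_continuousOn
      ((hS.cont y).mono fun s (hs : s ∈ Icc 0 (r₀ + 1)) => hs.1)
    exact ⟨C, fun s => hC s s.2⟩
  have h1 : Tendsto (fun i => S (r i) (x i - x₀)) l (𝓝 0) := by
    refine squeeze_zero_norm' (a := fun i => M * ‖x i - x₀‖) ?_ ?_
    · filter_upwards [hr0, hr.eventually (Iio_mem_nhds (lt_add_one r₀))] with i hi1 hi2
      exact (S (r i)).le_of_opNorm_le (hM ⟨r i, hi1, le_of_lt hi2⟩) _
    · simpa using (tendsto_iff_norm_sub_tendsto_zero.1 hx).const_mul M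
  have h2 : Tendsto (fun i => S (r i) x₀) l (𝓝 (S r₀ x₀)) :=
    ((hS.cont x₀) r₀ hr₀).tendsto.comp (tendsto_nhdsWithin_iff.2 ⟨hr, hr0⟩)
  simpa using h1.add h2

end GeneratesAnalytic

/-- An integrable solution of `q' + A q = 0` is given by the semigroup. -/
theorem HasWeakDeriv.eq_semigroup [CompleteSpace X0] [CompleteSpace X1]
    {S : ℝ → X0 →L[ℝ] X0} (hS : GeneratesAnalytic ι A S) {a : ℝ≥0∞}
    {q : ℝ → X1} {Q : ℝ → X0} (H : HasWeakDeriv ι a q Q (fun t => -A (q t)))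
    (hq : ∀ t ∈ timeInterval a, IntegrableOn q (Icc 0 t)) {t : ℝ} (ht : t ∈ timeInterval a) :
    Q t = S t (Q 0) := by
  -- the primitive `P` of `q` solves `(ι P)' + A P = Q 0`
  set P : ℝ → X1 := fun s => ∫ r in (0 : ℝ)..s, q r with hP
  have hqi : ∀ s ∈ timeInterval a, IntervalIntegrable q volume 0 s := fun s hs => by
    rw [intervalIntegrable_iff_integrableOn_Icc_of_le hs.1]
    exact hq s hs
  have hQcont := H.continuousOn
  have hιP : ∀ s ∈ timeInterval a, ι (P s) = ∫ r in (0 : ℝ)..s, Q r := fun s hs => by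
    rw [hP, ← ι.intervalIntegral_comp_comm (hqi s hs)]
    refine intervalIntegral.integral_congr_ae ?_
    rw [uIoc_of_le hs.1]
    exact ae_Ioc_of_ae_timeInterval hs H.ae_eq
  have hAP : ∀ s ∈ timeInterval a, -A (P s) = Q s - Q 0 := fun s hs => by
    rw [hP, ← A.intervalIntegral_comp_comm (hqi s hs), H.rep s hs, add_sub_cancel_left,
      intervalIntegral.integral_neg]
  have hint : ∀ s ∈ timeInterval a,
      ∫ r in (0 : ℝ)..s, Q r = ∫ r in (0 : ℝ)..s, S r (Q 0) := by
    intro s hs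
    have hIcc := Icc_subset_timeInterval hs
    have hιPcont : ContinuousOn (fun r => ι (P r)) (Icc 0 s) := by
      refine ι.continuous.comp_continuousOn ?_
      have := intervalIntegral.continuousOn_primitive_interval' (hqi s hs) left_mem_uIcc
      rwa [uIcc_of_le hs.1] at this
    have hcont : ContinuousOn (fun r => S (s - r) (ι (P r))) (uIcc 0 s) := by
      rw [uIcc_of_le hs.1]
      intro r hr
      refine hS.tendsto_apply ?_ ?_ (by linarith [hr.2]) (hιPcont r hr)
      · exact (tendsto_const_nhds.sub tendsto_id).mono_left nhdsWithin_le_nhds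
      · filter_upwards [self_mem_nhdsWithin] with r' hr'
        linarith [hr'.2]
    have hS0 : ContinuousOn (fun r => S (s - r) (Q 0)) (uIcc 0 s) := by
      rw [uIcc_of_le hs.1]
      exact (hS.cont (Q 0)).comp (by fun_prop) fun r hr => by
        simpa using hr.2
    have key := intervalIntegral.integral_eq_sub_of_hasDeriv_right hcont
      (f' := fun r => S (s - r) (Q 0)) ?_ hS0.intervalIntegrable
    · rw [intervalIntegral.integral_comp_sub_left (fun r => S r (Q 0))] at key
      simp only [sub_self, sub_zero, hS.zero, ContinuousLinearMap.id_apply] at key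
      rw [key, hP]
      simp [← hιP s hs, hP]
    · intro r hr
      rw [min_eq_left hs.1, max_eq_right hs.1] at hr
      have hrs := hIcc ⟨hr.1.le, hr.2.le⟩
      -- the right derivatives at `r` of `ι ∘ P` and of the orbit of `ι (P r)`
      have hd1 : HasDerivWithinAt (fun r => ι (P r)) (Q r) (Ioi r) r := by
        have hQr : ContinuousAt Q r :=
          (hQcont.mono hIcc).continuousAt (Icc_mem_nhds hr.1 hr.2)
        have := intervalIntegral.integral_hasDerivAt_right
          (f := Q) (a := 0) (b := r) ?_ ?_ hQr
        · refine (this.congr_of_eventuallyEq ?_).hasDerivWithinAt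
          filter_upwards [Icc_mem_nhds hr.1 hr.2] with r' hr'
          exact hιP r' (hIcc hr')
        · refine ContinuousOn.intervalIntegrable ?_
          rw [uIcc_of_le hr.1.le]
          exact hQcont.mono (Icc_subset_timeInterval hrs)
        · exact ContinuousOn.stronglyMeasurableAtFilter_nhdsWithin
            (hQcont.mono hIcc) measurableSet_Icc r |>.filter_mono (by
              rw [nhdsWithin_eq_nhds.2 (Icc_mem_nhds hr.1 hr.2)])
      have hd2 := (hS.generator (ι (P r)) (-A (P r))).2 ⟨P r, rfl, rfl⟩
      rw [hAP r hrs] at hd2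
      rw [hasDerivWithinAt_iff_tendsto_slope' (notMem_Ioi.2 le_rfl)] at hd1 ⊢
      have hd2' : Tendsto (fun r' => (r' - r)⁻¹ • (S (r' - r) (ι (P r)) - ι (P r)))
          (𝓝[>] r) (𝓝 (Q r - Q 0)) := by
        refine hd2.comp (tendsto_nhdsWithin_iff.2 ⟨?_, ?_⟩)
        · have : Tendsto (fun r' => r' - r) (𝓝 r) (𝓝 (r - r)) :=
            (tendsto_id).sub tendsto_const_nhds
          rw [sub_self] at this
          exact this.mono_left nhdsWithin_le_nhds
        · filter_upwards [self_mem_nhdsWithin] with r' hr'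
          exact sub_pos.2 (mem_Ioi.1 hr')
      have hd3 := hS.tendsto_apply (r := fun r' => s - r') (l := 𝓝[>] r) (r₀ := s - r)
        ((tendsto_const_nhds.sub tendsto_id).mono_left nhdsWithin_le_nhds)
        (by
          filter_upwards [mem_nhdsWithin_of_mem_nhds (Iio_mem_nhds hr.2)] with r' hr'
          linarith [mem_Iio.1 hr']) (by linarith [hr.2]) (hd1.sub hd2')
      rw [sub_sub_cancel] at hd3
      refine hd3.congr' ?_
      filter_upwards [self_mem_nhdsWithin,
        mem_nhdsWithin_of_mem_nhds (Iio_mem_nhds hr.2)] with r' hr1 hr2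
      have hadd : S (s - r) (ι (P r)) = S (s - r') (S (r' - r) (ι (P r))) := by
        have := hS.add (s - r') (r' - r) (by linarith [mem_Iio.1 hr2]) (by linarith [mem_Ioi.1 hr1])
        rw [sub_add_sub_cancel] at this
        rw [this, ContinuousLinearMap.comp_apply]
      rw [slope_def_module, slope_def_module, ← smul_sub, map_smul, hadd, ← map_sub (S (s - r')),
        sub_sub_sub_cancel_right]
  rcases eq_or_lt_of_le ht.1 with h0 | h0
  · rw [← h0, hS.zero, ContinuousLinearMap.id_apply]
  · -- both primitives have the same left derivative at `t`
    have hIcc := Icc_subset_timeInterval ht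
    have hd : ∀ f : ℝ → X0, ContinuousOn f (Icc 0 t) →
        HasDerivWithinAt (fun s => ∫ r in (0 : ℝ)..s, f r) (f t) (Icc 0 t) t := by
      intro f hf
      have : Fact (t ∈ Icc 0 t) := ⟨right_mem_Icc.2 ht.1⟩
      exact intervalIntegral.integral_hasDerivWithinAt_right
        (hf.intervalIntegrable_of_Icc ht.1)
        (hf.stronglyMeasurableAtFilter_nhdsWithin measurableSet_Icc t)
        (hf t (right_mem_Icc.2 ht.1))
    have h1 := hd Q (hQcont.mono hIcc)
    have h2 := hd (fun s => S s (Q 0)) ((hS.cont _).mono Icc_subset_Ici_self)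
    refine (uniqueDiffOn_Icc h0 t (right_mem_Icc.2 ht.1)).eq_deriv _ h1 ?_
    exact h2.congr (fun s hs => hint s (hIcc hs)) (hint t ht)

/-! ### The projection onto the kernel -/

/-- The spectral projection onto `N(A)` along `R(A)`, as a bounded operator from `X₀` to `X₁`:
the value of the projection at `y ∈ X₀` is `ι (κ y)`. -/
theorem exists_kernel_projection [CompleteSpace X0] [CompleteSpace X1]
    (hι : Function.Injective ι) (hA : IsCompl (kerSpace ι A) (rangeSpace A)) :
    ∃ κ : X0 →L[ℝ] X1, (∀ y, A (κ y) = 0) ∧ (∀ x, κ (A x) = 0) ∧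
      (∀ x, A x = 0 → κ (ι x) = x) ∧ (∀ y, stableProj ι A hA y = y - ι (κ y)) := by
  set p := (kerSpace ι A).projection (rangeSpace A) hA with hp
  have hpk : ∀ y, ∃ x : X1, A x = 0 ∧ ι x = p y := fun y => by
    obtain ⟨x, hx, hx'⟩ := Submodule.projection_apply_mem hA y
    exact ⟨x, hx, hx'⟩
  choose k hk1 hk2 using hpk
  let kl : X0 →ₗ[ℝ] X1 :=
    { toFun := k
      map_add' := fun x y => hι (by rw [map_add, hk2, hk2, hk2, map_add])
      map_smul' := fun c x => hι (by simp [hk2]) }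
  -- boundedness: the map `(x, y) ↦ ι x + A y` on `N(A) × X₁` is open
  have hclosed : IsClosed ((LinearMap.ker (A : X1 →ₗ[ℝ] X0) : Submodule ℝ X1) : Set X1) :=
    A.isClosed_ker
  have : CompleteSpace (LinearMap.ker (A : X1 →ₗ[ℝ] X0)) := hclosed.completeSpace_coe
  let L : (LinearMap.ker (A : X1 →ₗ[ℝ] X0)) × X1 →L[ℝ] X0 :=
    (ι.comp (Submodule.subtypeL _)).coprod A
  have hLp : ∀ z, p (L z) = ι z.1 := fun z => by
    have e1 : p (ι z.1) = ι z.1 :=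
      Submodule.projection_apply_of_mem_left hA ⟨z.1, z.1.2, rfl⟩
    have e2 : p (A z.2) = 0 :=
      (Submodule.projection_apply_eq_zero_iff hA).2 ⟨z.2, rfl⟩
    have e3 : L z = ι z.1 + A z.2 := rfl
    rw [e3, map_add, e1, e2, add_zero]
  have hL : Function.Surjective L := fun y => by
    obtain ⟨z, hz⟩ : y - p y ∈ rangeSpace A := Submodule.sub_projection_mem hA y
    refine ⟨(⟨k y, hk1 y⟩, z), ?_⟩
    change ι (k y) + A z = y
    rw [hk2, show A z = y - p y from hz]
    abel
  obtain ⟨C, -, hC⟩ := L.exists_preimage_norm_le hL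
  have hbound : ∀ y, ‖kl y‖ ≤ C * ‖y‖ := fun y => by
    obtain ⟨z, rfl, hz⟩ := hC y
    have : kl (L z) = z.1 := hι ((hk2 _).trans (hLp z))
    rw [this]
    exact (norm_fst_le z).trans hz
  refine ⟨kl.mkContinuous C hbound, hk1, fun x => hι ?_, fun x hx => hι ?_, fun y => ?_⟩
  · change ι (k _) = _
    rw [hk2, map_zero]
    exact (Submodule.projection_apply_eq_zero_iff hA).2 ⟨x, rfl⟩
  · change ι (k _) = _
    rw [hk2]
    exact Submodule.projection_apply_of_mem_left hA ⟨x, hx, rfl⟩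
  · change _ = y - ι (k y)
    rw [hk2]
    exact Submodule.projection_eq_self_sub_projection hA y

/-! ### The manifold of equilibria -/

/-- Near an equilibrium, the manifold of equilibria is a Lipschitz graph over the kernel `N(A)`,
to which it is tangent. -/
theorem IsEquilibriumManifold.exists_graph [CompleteSpace X0] [CompleteSpace X1]
    {F : X1 → X0} {U₁ : Set X1} {u : X1} {m : ℕ}
    {U : Set (EuclideanSpace ℝ (Fin m))} {Ψ : EuclideanSpace ℝ (Fin m) → X1}
    (hM : IsEquilibriumManifold F U₁ u m U Ψ)
    (htangent : LinearMap.range (fderiv ℝ Ψ 0 : EuclideanSpace ℝ (Fin m) →ₗ[ℝ] X1)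
      = LinearMap.ker (A : X1 →ₗ[ℝ] X0))
    {κ : X0 →L[ℝ] X1} (hκ1 : ∀ y, A (κ y) = 0) (hκ2 : ∀ x, A x = 0 → κ (ι x) = x) :
    ∃ Φ : X0 → X1, ∃ C : ℝ≥0, ∃ ρ : ℝ, 0 < ρ ∧ Φ 0 = 0 ∧
      (∀ y, ‖y‖ < ρ → Φ y + u ∈ Ψ '' U ∧ κ (ι (Φ y)) = κ y) ∧
      ∀ y y', ‖y‖ < ρ → ‖y'‖ < ρ → ‖Φ y - Φ y'‖ ≤ C * ‖κ (y - y')‖ := by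
  have hΨ : HasStrictFDerivAt Ψ (fderiv ℝ Ψ 0) 0 :=
    (hM.smooth.contDiffAt (hM.isOpen.mem_nhds hM.zero_mem)).hasStrictFDerivAt one_ne_zero
  set N := LinearMap.ker (A : X1 →ₗ[ℝ] X0) with hN
  have hclosed : IsClosed (N : Set X1) := A.isClosed_ker
  have : CompleteSpace N := hclosed.completeSpace_coe
  let κN : X0 →L[ℝ] N := κ.codRestrict N fun y => hκ1 y
  set D : EuclideanSpace ℝ (Fin m) →L[ℝ] N := (κN.comp ι).comp (fderiv ℝ Ψ 0) with hD
  have hDapp : ∀ ζ, (D ζ : X1) = fderiv ℝ Ψ 0 ζ := fun ζ => by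
    refine hκ2 _ ?_
    have : fderiv ℝ Ψ 0 ζ ∈ N := by rw [← htangent]; exact ⟨ζ, rfl⟩
    exact this
  have hker : LinearMap.ker (fderiv ℝ Ψ 0 : EuclideanSpace ℝ (Fin m) →ₗ[ℝ] X1) = ⊥ := by
    have := LinearMap.finrank_range_add_finrank_ker
      (fderiv ℝ Ψ 0 : EuclideanSpace ℝ (Fin m) →ₗ[ℝ] X1)
    rw [hM.rank, finrank_euclideanSpace_fin] at this
    exact Submodule.finrank_eq_zero.1 (by omega)
  have hDker : LinearMap.ker (D : EuclideanSpace ℝ (Fin m) →ₗ[ℝ] N) = ⊥ := by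
    rw [LinearMap.ker_eq_bot'] at hker ⊢
    intro ζ hζ
    refine hker ζ ?_
    have := hDapp ζ
    rw [show D ζ = 0 from hζ] at this
    exact this.symm
  have hDrange : LinearMap.range (D : EuclideanSpace ℝ (Fin m) →ₗ[ℝ] N) = ⊤ := by
    rw [LinearMap.range_eq_top]
    intro x
    obtain ⟨ζ, hζ⟩ : (x : X1) ∈
        LinearMap.range (fderiv ℝ Ψ 0 : EuclideanSpace ℝ (Fin m) →ₗ[ℝ] X1) := by
      rw [htangent]; exact x.2
    exact ⟨ζ, Subtype.ext ((hDapp ζ).trans hζ)⟩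
  let e := ContinuousLinearEquiv.ofBijective D hDker hDrange
  have hf : HasStrictFDerivAt (fun ζ => κN (ι (Ψ ζ - u)))
      (e : EuclideanSpace ℝ (Fin m) →L[ℝ] N) 0 :=
    ((κN.comp ι).hasStrictFDerivAt.comp 0 (hΨ.sub_const u))
  set f := fun ζ => κN (ι (Ψ ζ - u)) with hfdef
  have hf0 : f 0 = 0 := by simp [hfdef, hM.base]
  set g := hf.localInverse with hg
  have hg0 : g 0 = 0 := by
    have := hf.localInverse_apply_image
    rwa [hf0] at this
  have hgstrict : HasStrictFDerivAt g (e.symm : N →L[ℝ] EuclideanSpace ℝ (Fin m)) 0 := by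
    have := hf.to_localInverse
    rwa [hf0] at this
  have hcomp : HasStrictFDerivAt (fun y => Ψ (g y)) _ 0 :=
    HasStrictFDerivAt.comp (0 : N) (g := Ψ) (f := g) (by rw [hg0]; exact hΨ) hgstrict
  obtain ⟨K, s, hs, hK⟩ := hcomp.exists_lipschitzOnWith
  have hev : ∀ᶠ y in 𝓝 (0 : N), y ∈ s ∧ g y ∈ U ∧ f (g y) = y := by
    have h1 : ∀ᶠ y in 𝓝 (0 : N), f (g y) = y := by
      have := hf.eventually_right_inverse
      rwa [hf0] at this
    have h2 : ∀ᶠ y in 𝓝 (0 : N), g y ∈ U :=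
      hgstrict.continuousAt.eventually (by rw [hg0]; exact hM.isOpen.mem_nhds hM.zero_mem)
    filter_upwards [hs, h2, h1] with y hy1 hy2 hy3 using ⟨hy1, hy2, hy3⟩
  have hev' : ∀ᶠ y in 𝓝 (0 : X0), κN y ∈ s ∧ g (κN y) ∈ U ∧ f (g (κN y)) = κN y :=
    (κN.continuous.tendsto' 0 0 (map_zero _)).eventually hev
  obtain ⟨ρ, hρ, hball⟩ := Metric.eventually_nhds_iff.1 hev'
  simp only [dist_zero_right] at hball
  refine ⟨fun y => Ψ (g (κN y)) - u, K, ρ, hρ, ?_, fun y hy => ⟨?_, ?_⟩, fun y y' hy hy' => ?_⟩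
  · simp [hg0, hM.base]
  · rw [sub_add_cancel]
    exact ⟨_, (hball hy).2.1, rfl⟩
  · exact congrArg Subtype.val (hball hy).2.2
  · have := hK.dist_le_mul _ (hball hy).1 _ (hball hy').1
    rw [dist_eq_norm, dist_eq_norm, ← map_sub] at this
    rw [sub_sub_sub_cancel_right]
    exact this

end

/-! ### A perturbation estimate for the linear equation -/

theorem le_two_mul_of_le_add_mul {K x y : ℝ≥0∞} (hK : K ≠ ∞) (hy : y ≤ 2⁻¹)
    (h : K ≤ x + y * K) : K ≤ 2 * x := by
  have h2 : K / 2 + K / 2 ≤ x + K / 2 := by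
    rw [ENNReal.add_halves]
    refine h.trans (add_le_add_right ?_ _)
    rw [div_eq_mul_inv, mul_comm]
    gcongr
  have h3 : K / 2 ≤ x := (ENNReal.add_le_add_iff_right (ENNReal.div_ne_top hK (by simp))).1 h2
  rw [← ENNReal.add_halves K, two_mul]
  exact add_le_add h3 h3

section

variable {X0 X1 : Type*} [NormedAddCommGroup X0] [NormedSpace ℝ X0]
  [NormedAddCommGroup X1] [NormedSpace ℝ X1] {ι A : X1 →L[ℝ] X0}

theorem BanachFunctionSpace.integrableOn {X : Type*} [NormedAddCommGroup X] [NormedSpace ℝ X]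
    {a : ℝ≥0∞} (B : BanachFunctionSpace X a) {w : ℝ → X} (hw : B.nrm w < ∞) {t : ℝ}
    (ht : t ∈ timeInterval a) : IntegrableOn w (Icc 0 t) := by
  obtain ⟨C, hC⟩ := B.embed t ht.2
  refine ⟨(B.measurable w hw).mono_measure
    (Measure.restrict_mono_set _ (Icc_subset_timeInterval ht)), ?_⟩
  exact (hC w hw).trans_lt (ENNReal.mul_lt_top ENNReal.coe_lt_top hw)

/-- The weighted integral bound, without the weight, on bounded intervals. -/
theorem CondA2.exists_lintegral_le {E : FunctionSpacePair ι} {ω : ℝ} (hω : 0 < ω)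
    (h2 : CondA2 E ω) (L : ℝ) :
    ∃ C : ℝ≥0, ∀ τ : ℝ, 0 < τ → τ ≤ L → ∀ w : ℝ → X1, (E.E1 (ENNReal.ofReal τ)).nrm w < ∞ →
      ∫⁻ s in timeInterval (ENNReal.ofReal τ), ‖w s‖ₑ
        ≤ C * (E.E1 (ENNReal.ofReal τ)).nrm w := by
  obtain ⟨c, hc, -⟩ := h2.integral
  refine ⟨(Real.exp (ω * L)).toNNReal * c, fun τ hτ hτL w hw => ?_⟩
  have h := hc (ENNReal.ofReal τ) (by simpa using hτ) w hw
  rw [ENNReal.coe_mul, mul_assoc]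
  refine le_trans ?_ (mul_le_mul_right h _)
  rw [← lintegral_const_mul' _ _ ENNReal.coe_ne_top]
  refine setLIntegral_mono_ae' (measurableSet_timeInterval _) (.of_forall fun s hs => ?_)
  rw [timeInterval_ofReal] at hs
  rw [← mul_assoc]
  refine le_mul_of_one_le_left' ?_
  change 1 ≤ ENNReal.ofReal _ * _
  rw [← ENNReal.ofReal_mul (Real.exp_pos _).le, ← Real.exp_add, ENNReal.one_le_ofReal,
    Real.one_le_exp_iff]
  nlinarith [hs.2]

/-- The estimate that drives the argument. Let `w' + A w = g` with `w(0) ∈ R(A)` and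
`|g(t)|₀ ≤ β |w(t)|₁`, where `β` is small. Then, on bounded intervals, `w` is close to the orbit
`e^{-tA} w(0)`, with constants that do not depend on the length of the interval. -/
theorem exists_dist_semigroup_le [CompleteSpace X0] [CompleteSpace X1]
    (hι : Function.Injective ι) {S : ℝ → X0 →L[ℝ] X0} (hS : GeneratesAnalytic ι A S)
    {hA : IsCompl (kerSpace ι A) (rangeSpace A)} {ω : ℝ} (hω : 0 < ω) {E : FunctionSpacePair ι}
    (h1 : CondA1 E) (h2 : CondA2 E ω) (h4 : CondA4 E A S hA ω)
    {κ : X0 →L[ℝ] X1} (hκ1 : ∀ y, A (κ y) = 0) (hκ2 : ∀ x, κ (A x) = 0)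
    (hκ3 : ∀ x, A x = 0 → κ (ι x) = x) (hκ4 : ∀ y, stableProj ι A hA y = y - ι (κ y))
    (L : ℝ) :
    ∃ C β₀ : ℝ≥0, 0 < β₀ ∧ ∀ β ≤ β₀, ∀ τ : ℝ, 0 < τ → τ ≤ L →
      ∀ (w : ℝ → X1) (W g : ℝ → X0), (E.E1 (ENNReal.ofReal τ)).nrm w < ∞ →
        HasWeakDeriv ι (ENNReal.ofReal τ) w W (fun t => g t - A (w t)) →
        (E.E0 (ENNReal.ofReal τ)).nrm g < ∞ → κ (W 0) = 0 →
        (∀ᵐ t ∂(volume.restrict (timeInterval (ENNReal.ofReal τ))), ‖g t‖ ≤ β * ‖w t‖) →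
        ∀ t ∈ timeInterval (ENNReal.ofReal τ),
          gammaNorm E (W t - S t (W 0)) ≤ C * β * gammaNorm E (W 0) ∧
            ‖κ (W t)‖ₑ ≤ C * β * gammaNorm E (W 0) := by
  set L₁ : X1 →L[ℝ] X1 := ContinuousLinearMap.id ℝ X1 - κ.comp ι with hL₁
  set L₀ : X0 →L[ℝ] X0 := ContinuousLinearMap.id ℝ X0 - ι.comp κ with hL₀
  have hL₁a : ∀ x, L₁ x = x - κ (ι x) := fun x => rfl
  have hL₀a : ∀ x, L₀ x = x - ι (κ x) := fun x => rfl
  have hκκ : ∀ y, κ (ι (κ y)) = κ y := fun y => hκ3 _ (hκ1 y)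
  obtain ⟨M₀, hM₀⟩ := h4.solve
  obtain ⟨M₁, hM₁⟩ := h4.semigroup
  obtain ⟨c₀, hc₀⟩ := h1.trace_zero
  obtain ⟨c₁, hc₁⟩ := h2.exists_lintegral_le hω L
  obtain ⟨cγ, hcγ⟩ := exists_gammaNorm_le E h1
  obtain ⟨cL, hcL⟩ := E.const L
  -- `D` bounds the center part by the stable part, `c` is the constant of the domination
  set D : ℝ≥0 := 2 * (‖κ‖₊ * c₁) with hD
  set c : ℝ≥0 := ‖L₀‖₊ * (‖L₁‖₊ + ‖κ.comp ι‖₊) with hc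
  set B : ℝ≥0 := M₀ * (c * (1 + cL * D)) with hB
  set β₀ : ℝ≥0 := min 1 (min (2 * (‖κ‖₊ * L.toNNReal + 1))⁻¹ (2 * (B + 1))⁻¹) with hβ₀
  refine ⟨c₀ * B * (2 * M₁) + cγ * D * (2 * M₁) + D * (2 * M₁), β₀, by positivity, ?_⟩
  intro β hβ τ hτ hτL w W g hw H hg hκ0 hgw t ht
  have hβ1 : β ≤ 1 := hβ.trans (min_le_left _ _)
  have hβ2 : β ≤ (2 * (‖κ‖₊ * L.toNNReal + 1))⁻¹ :=
    hβ.trans ((min_le_right _ _).trans (min_le_left _ _))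
  have hβ3 : β ≤ (2 * (B + 1))⁻¹ := hβ.trans ((min_le_right _ _).trans (min_le_right _ _))
  set a := ENNReal.ofReal τ with ha
  have ha0 : a ≠ 0 := by simpa [ha] using hτ
  have h0a : (0 : ℝ) ∈ timeInterval a := by
    rw [ha, timeInterval_ofReal]; exact ⟨le_rfl, hτ⟩
  set Y := gammaNorm E (W 0) with hY
  have hYfin : Y < ∞ := by
    obtain ⟨C, hC⟩ := h1.bounded a ha0
    exact (hC w W _ hw H 0 h0a).trans_lt (ENNReal.mul_lt_top ENNReal.coe_lt_top hw)
  have hPsg : (E.E0 a).nrm (fun t => stableProj ι A hA (g t)) < ∞ := h4.proj_mem a ha0 g hg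
  -- the stable part `ws` of `w` is the sum of `zs`, with trace zero, and of `wsg = e^{-tA} W 0`
  set ws : ℝ → X1 := fun t => L₁ (w t) with hws
  have Hs : HasWeakDeriv ι a ws (fun t => L₀ (W t))
      (fun t => stableProj ι A hA (g t) - A (ws t)) := by
    have := H.map (L₁ := L₁) (L₀ := L₀) fun x => by simp [hL₁a, hL₀a]
    convert this using 2 with t
    simp only [hws, hL₁a, hL₀a, hκ4, hκ1, hκ2, map_sub, sub_zero]
    abel
  have hσ : (0 : ℝ) ∈ Icc 0 ω := ⟨le_rfl, hω.le⟩
  obtain ⟨zs, Z, -, Hz, hZ0, hzs, -⟩ := hM₀ a ha0 0 hσ g (by simpa using hPsg)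
  obtain ⟨wsg, hwsg, hwsgn⟩ := hM₁ a ha0 0 hσ (W 0) hYfin
  have hPs0 : stableProj ι A hA (W 0) = W 0 := by rw [hκ4, hκ0, map_zero, sub_zero]
  simp only [zero_mul, Real.exp_zero, one_smul, hPs0] at hzs hwsg hwsgn
  replace hwsgn : (E.E1 a).nrm wsg ≤ M₁ * Y := le_self_add.trans hwsgn
  have hzfin : (E.E1 a).nrm zs < ∞ :=
    hzs.trans_lt (ENNReal.mul_lt_top ENNReal.coe_lt_top hPsg)
  have Hq : HasWeakDeriv ι a (fun t => ws t - zs t) (fun t => L₀ (W t) - Z t)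
      (fun t => -A (ws t - zs t)) := by
    convert Hs.sub Hz using 2 with t
    rw [map_sub]
    abel
  have hQ : ∀ t ∈ timeInterval a, L₀ (W t) - Z t = S t (W 0) := fun t ht => by
    rw [Hq.eq_semigroup hS (fun s hs => (L₁.integrable_comp ((E.E1 a).integrableOn hw hs)).sub
      ((E.E1 a).integrableOn hzfin hs)) ht, hZ0, hL₀a, hκ0, map_zero, sub_zero, sub_zero]
  have hsplit : ws =ᵐ[volume.restrict (timeInterval a)] fun t => zs t + wsg t := by
    have hne : ∀ᵐ t ∂(volume.restrict (timeInterval a)), t ≠ 0 :=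
      ae_restrict_of_ae (Measure.ae_ne volume 0)
    filter_upwards [Hq.ae_eq, ae_restrict_mem (measurableSet_timeInterval a), hne]
      with t ht1 ht2 ht3
    have : ws t - zs t = wsg t := hι (by
      rw [ht1, hQ t ht2, hwsg t (lt_of_le_of_ne ht2.1 (Ne.symm ht3))])
    rw [← this]
    abel
  set N := (E.E1 a).nrm ws with hN
  have hN1 : N ≤ M₀ * (E.E0 a).nrm (fun t => stableProj ι A hA (g t)) + M₁ * Y := by
    rw [hN, (E.E1 a).congr_ae _ _ hsplit]
    exact ((E.E1 a).add_le _ _).trans (add_le_add hzs hwsgn)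
  have hNfin : N < ∞ := hN1.trans_lt (ENNReal.add_lt_top.2
    ⟨ENNReal.mul_lt_top ENNReal.coe_lt_top hPsg, ENNReal.mul_lt_top ENNReal.coe_lt_top hYfin⟩)
  -- the center part is bounded by `K`
  set K := ∫⁻ t in timeInterval a, ‖κ (g t)‖ₑ with hK
  have hκW : ∀ t ∈ timeInterval a, ‖κ (W t)‖ₑ ≤ K := by
    intro t ht
    rw [H.rep t ht, map_add, hκ0, zero_add,
      ← κ.intervalIntegral_comp_comm (H.intervalIntegrable ht),
      intervalIntegral.integral_of_le ht.1]
    simp only [map_sub, hκ2, sub_zero]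
    exact (enorm_integral_le_lintegral_enorm _).trans (lintegral_mono_set
      (Ioc_subset_Icc_self.trans (Icc_subset_timeInterval ht)))
  have hκg : K ≤ ‖κ‖₊ * β * ∫⁻ t in timeInterval a, ‖w t‖ₑ := by
    rw [← ENNReal.coe_mul, ← lintegral_const_mul' _ _ ENNReal.coe_ne_top]
    refine lintegral_mono_ae ?_
    filter_upwards [hgw] with t ht
    have e : ‖κ (g t)‖₊ ≤ ‖κ‖₊ * β * ‖w t‖₊ := by
      rw [← NNReal.coe_le_coe]
      push_cast
      rw [mul_assoc]
      exact κ.le_opNorm_of_le ht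
    simpa [enorm_eq_nnnorm] using ENNReal.coe_le_coe.2 e
  have hKfin : K < ∞ := hκg.trans_lt (ENNReal.mul_lt_top (by finiteness)
    ((hc₁ τ hτ hτL w hw).trans_lt (ENNReal.mul_lt_top ENNReal.coe_lt_top hw)))
  have hwint : ∫⁻ t in timeInterval a, ‖w t‖ₑ ≤ c₁ * N + K * L.toNNReal := by
    calc ∫⁻ t in timeInterval a, ‖w t‖ₑ ≤ ∫⁻ t in timeInterval a, (‖ws t‖ₑ + K) := by
          refine lintegral_mono_ae ?_
          filter_upwards [H.ae_eq, ae_restrict_mem (measurableSet_timeInterval a)] with t h3 h4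
          have : w t = ws t + κ (W t) := by rw [← h3]; simp [hws, hL₁a]
          conv_lhs => rw [this]
          exact (enorm_add_le _ _).trans (add_le_add_right (hκW t h4) _)
      _ = (∫⁻ t in timeInterval a, ‖ws t‖ₑ) + K * ENNReal.ofReal τ := by
          rw [lintegral_add_right _ measurable_const, setLIntegral_const, ha,
            timeInterval_ofReal, Real.volume_Ico, sub_zero]
      _ ≤ c₁ * N + K * L.toNNReal := by
          gcongr
          · exact hc₁ τ hτ hτL ws hNfin
          · exact ENNReal.ofReal_le_ofReal hτL
  have hKN : K ≤ β * D * N := by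
    have : K ≤ 2 * (‖κ‖₊ * β * (c₁ * N)) := by
      refine le_two_mul_of_le_add_mul (y := ‖κ‖₊ * β * L.toNNReal) hKfin.ne ?_ ?_
      · have e : ‖κ‖₊ * β * L.toNNReal ≤ 2⁻¹ := by
          calc ‖κ‖₊ * β * L.toNNReal = β * (‖κ‖₊ * L.toNNReal) := by ring
            _ ≤ (2 * (‖κ‖₊ * L.toNNReal + 1))⁻¹ * (‖κ‖₊ * L.toNNReal + 1) := by
              gcongr; simp
            _ = 2⁻¹ := by field_simp
        have := ENNReal.coe_le_coe.2 e
        simpa using this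
      · refine hκg.trans ?_
        calc _ ≤ ‖κ‖₊ * β * (c₁ * N + K * L.toNNReal) := by gcongr
          _ = _ := by ring
    refine this.trans_eq ?_
    rw [hD]; push_cast; ring
  -- `P_s g` is dominated by a multiple of `ws + x`, where `x ∈ N(A)` has norm `K`
  obtain ⟨x, hx1, hx2⟩ : ∃ x, A x = 0 ∧ ‖x‖ₑ = K := by
    by_cases hy : ∃ y, κ y ≠ 0
    · obtain ⟨y, hy⟩ := hy
      refine ⟨(K.toReal / ‖κ y‖) • κ y, by rw [map_smul, hκ1, smul_zero], ?_⟩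
      rw [← ofReal_norm, norm_smul, norm_div, norm_norm, div_mul_cancel₀ _ (norm_ne_zero_iff.2 hy),
        Real.norm_of_nonneg ENNReal.toReal_nonneg, ENNReal.ofReal_toReal hKfin.ne]
    · push Not at hy
      exact ⟨0, map_zero _, by simp [hK, hy]⟩
  have hPs : (E.E0 a).nrm (fun t => stableProj ι A hA (g t)) ≤ c * β * (N + cL * K) := by
    have hx : (E.E1 a).nrm (fun _ => x) ≤ cL * K := by
      rw [← hx2]
      exact (E.restrict _ _ (ENNReal.ofReal_le_ofReal hτL) _).trans (hcL x)
    have hle : (E.E1 a).nrm (fun t => ((c * β : ℝ≥0) : ℝ) • (ws t + x))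
        ≤ c * β * (N + cL * K) := by
      rw [(E.E1 a).smul, ← ENNReal.coe_mul]
      refine mul_le_mul' (by rw [Real.enorm_eq_ofReal (NNReal.coe_nonneg _)]; simp) ?_
      exact ((E.E1 a).add_le _ _).trans (add_le_add_right hx _)
    refine (h2.domination a ha0 _ _ hPsg (hle.trans_lt (by finiteness)) ?_).trans hle
    filter_upwards [hgw, H.ae_eq, ae_restrict_mem (measurableSet_timeInterval a)] with t h3 h4 h5
    have e1 : w t = ws t + κ (W t) := by rw [← h4]; simp [hws, hL₁a]
    have e2 : ws t = L₁ (ws t + x) := by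
      rw [hws]
      simp [hL₁a, hκκ, hκ3 x hx1]
    have e3 : x = κ.comp ι (ws t + x) := by
      rw [hws]
      simp [hL₁a, hκκ, hκ3 x hx1]
    have e4 : ‖κ (W t)‖ ≤ ‖x‖ := by
      have := hκW t h5
      rw [← hx2] at this
      simpa [enorm_eq_nnnorm, ← NNReal.coe_le_coe] using this
    have e5 : ‖w t‖ ≤ (‖L₁‖ + ‖κ.comp ι‖) * ‖ws t + x‖ := by
      calc ‖w t‖ ≤ ‖ws t‖ + ‖κ (W t)‖ := by rw [e1]; exact norm_add_le _ _
        _ ≤ ‖ws t‖ + ‖x‖ := by gcongr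
        _ ≤ ‖L₁‖ * ‖ws t + x‖ + ‖κ.comp ι‖ * ‖ws t + x‖ := by
          refine add_le_add ?_ ?_
          · conv_lhs => rw [e2]
            exact L₁.le_opNorm _
          · conv_lhs => rw [e3]
            exact (κ.comp ι).le_opNorm _
        _ = _ := by ring
    rw [hκ4, ← hL₀a, norm_smul, Real.norm_of_nonneg (NNReal.coe_nonneg _)]
    calc ‖L₀ (g t)‖ ≤ ‖L₀‖ * (β * ‖w t‖) := L₀.le_opNorm_of_le h3
      _ ≤ ‖L₀‖ * (β * ((‖L₁‖ + ‖κ.comp ι‖) * ‖ws t + x‖)) := by gcongr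
      _ = _ := by rw [hc]; push_cast; ring
  have hPsN : M₀ * (E.E0 a).nrm (fun t => stableProj ι A hA (g t)) ≤ β * B * N := by
    calc _ ≤ M₀ * (c * β * (N + cL * (β * D * N))) := by gcongr; exact hPs.trans (by gcongr)
      _ ≤ M₀ * (c * β * (N + cL * (1 * D * N))) := by
        gcongr
        exact_mod_cast hβ1
      _ = β * B * N := by rw [hB]; push_cast; ring
  have hNY : N ≤ 2 * (M₁ * Y) := by
    refine le_two_mul_of_le_add_mul (y := β * B) hNfin.ne ?_ ?_
    · have e : β * B ≤ 2⁻¹ := by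
        calc β * B ≤ (2 * (B + 1))⁻¹ * (B + 1) := by gcongr; simp
          _ = 2⁻¹ := by field_simp
      have := ENNReal.coe_le_coe.2 e
      simpa using this
    · rw [add_comm]
      exact hN1.trans (add_le_add_left hPsN _)
  have hsum : W t - S t (W 0) = Z t + ι (κ (W t)) := by
    rw [← hQ t ht, hL₀a]
    abel
  refine ⟨?_, ?_⟩
  · calc gammaNorm E (W t - S t (W 0)) ≤ gammaNorm E (Z t) + gammaNorm E (ι (κ (W t))) := by
          rw [hsum]; exact gammaNorm_add_le E _ _
      _ ≤ c₀ * (β * B * N) + cγ * (β * D * N) := by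
          refine add_le_add ((hc₀ a ha0 zs Z _ hzfin Hz hZ0 t ht).trans ?_) ((hcγ _).trans ?_)
          · gcongr
            exact hzs.trans hPsN
          · gcongr
            exact (hκW t ht).trans hKN
      _ ≤ c₀ * (β * B * (2 * (M₁ * Y))) + cγ * (β * D * (2 * (M₁ * Y))) := by gcongr
      _ = (c₀ * B * (2 * M₁) + cγ * D * (2 * M₁) : ℝ≥0) * β * Y := by push_cast; ring
      _ ≤ _ := by
        gcongr ?_ * _ * _
        exact ENNReal.coe_le_coe.2 le_self_add
  · calc ‖κ (W t)‖ₑ ≤ β * D * (2 * (M₁ * Y)) :=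
          (hκW t ht).trans (hKN.trans (by gcongr))
      _ = (D * (2 * M₁) : ℝ≥0) * β * Y := by push_cast; ring
      _ ≤ _ := by
        gcongr ?_ * _ * _
        exact ENNReal.coe_le_coe.2 le_add_self

/-- On `R(A)`, the semigroup decays exponentially in the trace norm. -/
theorem CondA4.exists_decay {S : ℝ → X0 →L[ℝ] X0}
    {hA : IsCompl (kerSpace ι A) (rangeSpace A)} {ω : ℝ} (hω : 0 < ω) {E : FunctionSpacePair ι}
    (h4 : CondA4 E A S hA ω) :
    ∃ M : ℝ≥0, ∀ t : ℝ, 0 ≤ t → ∀ z : X0, gammaNorm E z < ∞ → stableProj ι A hA z = z →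
      gammaNorm E (S t z) ≤ ENNReal.ofReal (M * Real.exp (-(ω * t))) * gammaNorm E z := by
  obtain ⟨M, hM⟩ := h4.semigroup
  refine ⟨M, fun t ht z hz hPz => ?_⟩
  obtain ⟨w, -, hw⟩ := hM ∞ (by simp) ω ⟨hω.le, le_rfl⟩ z hz
  have ht' : t ∈ timeInterval ∞ := by rw [timeInterval_top]; exact ht
  have h := (le_iSup₂ (f := fun t (_ : t ∈ timeInterval ∞) =>
    gammaNorm E (Real.exp (ω * t) • S t (stableProj ι A hA z))) t ht').trans
      (le_add_self.trans hw)
  rw [hPz] at h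
  calc gammaNorm E (S t z)
      = gammaNorm E (Real.exp (-(ω * t)) • Real.exp (ω * t) • S t z) := by
        rw [smul_smul, ← Real.exp_add, neg_add_cancel, Real.exp_zero, one_smul]
    _ ≤ ‖Real.exp (-(ω * t))‖ₑ * gammaNorm E (Real.exp (ω * t) • S t z) :=
        gammaNorm_smul_le E (Real.exp_pos _).ne' _
    _ ≤ ENNReal.ofReal (Real.exp (-(ω * t))) * (M * gammaNorm E z) := by
        rw [Real.enorm_eq_ofReal (Real.exp_pos _).le]
        gcongr
    _ = _ := by
        rw [ENNReal.ofReal_mul M.coe_nonneg, ENNReal.ofReal_coe_nnreal]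
        ring

end

section

variable {X0 X1 : Type*} [NormedAddCommGroup X0] [NormedSpace ℝ X0]
  [NormedAddCommGroup X1] [NormedSpace ℝ X1] {ι A : X1 →L[ℝ] X0}

/-! ### Solutions of the shifted equation -/

namespace SolvesShifted

variable {E : FunctionSpacePair ι} {F : X1 → X0} {U₁ : Set X1} {u : X1} {a b : ℝ≥0∞} {v₀ : X0}
  {v v' : ℝ → X1} {V V' : ℝ → X0}

theorem mono (h : SolvesShifted E F U₁ u b v₀ v V) (hab : a ≤ b) :
    SolvesShifted E F U₁ u a v₀ v V where
  mem := (E.restrict a b hab v).trans_lt h.mem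
  dom := ae_restrict_of_ae_restrict_of_subset (timeInterval_mono hab) h.dom
  eqn := h.eqn.mono hab
  init := h.init

theorem congr_ae (h : SolvesShifted E F U₁ u a v₀ v V) (ha : a ≠ 0)
    (hv : v' =ᵐ[volume.restrict (timeInterval a)] v) (hV : EqOn V' V (timeInterval a)) :
    SolvesShifted E F U₁ u a v₀ v' V' where
  mem := by rw [(E.E1 a).congr_ae _ _ hv]; exact h.mem
  dom := by filter_upwards [hv, h.dom] with t h1 h2; rwa [h1]
  eqn := h.eqn.congr_ae hv hV (by filter_upwards [hv] with t h1; rw [h1])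
  init := by rw [hV ⟨le_rfl, by simpa [pos_iff_ne_zero] using ha⟩, h.init]

theorem translate {T s : ℝ} (h : SolvesShifted E F U₁ u (ENNReal.ofReal T) v₀ v V)
    (hs : 0 ≤ s) (hsT : s < T) :
    SolvesShifted E F U₁ u (ENNReal.ofReal (T - s)) (V s) (fun t => v (t + s))
      (fun t => V (t + s)) where
  mem := E.translate s T hs hsT v h.mem
  dom := by
    refine ae_restrict_of_ae_restrict_of_subset ?_ (ae_comp_add_right (c := s) h.dom)
    intro t ht
    rw [timeInterval_ofReal] at ht
    rw [mem_preimage, timeInterval_ofReal]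
    exact ⟨by linarith [ht.1], by linarith [ht.2]⟩
  eqn := h.eqn.translate hs
  init := by simp

theorem glue {s s' T : ℝ} (hs : 0 ≤ s) (hss : s < s') (hsT : s' ≤ s + T)
    (h : SolvesShifted E F U₁ u (ENNReal.ofReal s') v₀ v V)
    (h' : SolvesShifted E F U₁ u (ENNReal.ofReal T) (V s) (fun t => v (t + s))
      (fun t => V (t + s))) :
    SolvesShifted E F U₁ u (ENNReal.ofReal (s + T)) v₀ v V where
  mem := E.glue s s' T hs hss hsT v h.mem h'.mem
  dom := by
    have hsub : timeInterval (ENNReal.ofReal (s + T)) ⊆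
        timeInterval (ENNReal.ofReal s') ∪
          (fun t => t + -s) ⁻¹' timeInterval (ENNReal.ofReal T) := by
      intro t ht
      simp only [timeInterval_ofReal, mem_union, mem_preimage, mem_Ico] at ht ⊢
      rcases lt_or_ge t s' with hst | hst
      · exact Or.inl ⟨ht.1, hst⟩
      · exact Or.inr ⟨by linarith, by linarith⟩
    refine ae_restrict_of_ae_restrict_of_subset hsub ?_
    rw [ae_restrict_union_iff]
    exact ⟨h.dom, by simpa using ae_comp_add_right (c := -s) h'.dom⟩
  eqn := h.eqn.glue hs hss h'.eqn
  init := h.init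

/-- Solutions that agree almost everywhere have the same continuous representative. -/
theorem eqOn_rep (h : SolvesShifted E F U₁ u a v₀ v V) (h' : SolvesShifted E F U₁ u a v₀ v' V')
    (hv : v =ᵐ[volume.restrict (timeInterval a)] v') : EqOn V V' (timeInterval a) :=
  h.eqn.eqOn_rep h'.eqn (h.init.trans h'.init.symm)
    (by filter_upwards [hv] with t h1; rw [h1])

/-- The difference of a solution and an equilibrium solves the linear equation, with the
difference of the nonlinearities on the right. -/
theorem sub_equilibrium {A : X1 →L[ℝ] X0} (hA : A = fderiv ℝ F u) (h3 : CondA3 E A) {τ : ℝ}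
    (hτ : 0 < τ) (h : SolvesShifted E F U₁ u (ENNReal.ofReal τ) v₀ v V) {e : X1}
    (he : F (e + u) = 0) :
    (E.E1 (ENNReal.ofReal τ)).nrm (fun t => v t - e) < ∞ ∧
    HasWeakDeriv ι (ENNReal.ofReal τ) (fun t => v t - e) (fun t => V t - ι e)
      (fun t => nonlin F u (v t) - nonlin F u e - A (v t - e)) ∧
    (E.E0 (ENNReal.ofReal τ)).nrm (fun t => nonlin F u (v t) - nonlin F u e) < ∞ := by
  have hGe : nonlin F u e = A e := by rw [nonlin, he, sub_zero, hA]
  have hmem : (E.E1 (ENNReal.ofReal τ)).nrm (fun t => v t - e) < ∞ := by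
    obtain ⟨C, hC⟩ := E.const τ
    simp only [sub_eq_add_neg]
    exact ((E.E1 _).add_le _ _).trans_lt
      (ENNReal.add_lt_top.2 ⟨h.mem, (hC (-e)).trans_lt (by finiteness)⟩)
  have hder : HasWeakDeriv ι (ENNReal.ofReal τ) (fun t => v t - e) (fun t => V t - ι e)
      (fun t => nonlin F u (v t) - nonlin F u e - A (v t - e)) := by
    convert h.eqn.sub (HasWeakDeriv.const e) using 2 with t
    rw [hGe, map_sub, ← hA]
    abel
  refine ⟨hmem, hder, ?_⟩
  convert h3.maps τ hτ _ _ _ hmem hder using 3 with t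
  abel

end SolvesShifted

/-- Solvability for small initial values; uniqueness includes the continuous representatives. -/
theorem CondA6.exists_unique {E : FunctionSpacePair ι} {F : X1 → X0} {U₁ : Set X1} {u : X1}
    (h6 : CondA6 E F U₁ u) {b : ℝ} (hb : 0 < b) :
    ∃ r : ℝ, 0 < r ∧ ∀ v₀, gammaNorm E v₀ < ENNReal.ofReal r →
      (∃ v V, SolvesShifted E F U₁ u (ENNReal.ofReal b) v₀ v V) ∧
      ∀ v V v' V', SolvesShifted E F U₁ u (ENNReal.ofReal b) v₀ v V →
        SolvesShifted E F U₁ u (ENNReal.ofReal b) v₀ v' V' →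
        v =ᵐ[volume.restrict (timeInterval (ENNReal.ofReal b))] v' ∧
          EqOn V V' (timeInterval (ENNReal.ofReal b)) := by
  obtain ⟨r, hr, h⟩ := h6 b hb
  refine ⟨r, hr, fun v₀ hv₀ => ?_⟩
  obtain ⟨z, Z, hz, huniq⟩ := h v₀ hv₀
  refine ⟨⟨z, Z, hz⟩, fun v V v' V' hv hv' => ?_⟩
  have e := (huniq v V hv).trans (huniq v' V' hv').symm
  exact ⟨e, hv.eqOn_rep hv' e⟩

/-! ### One step of the discrete dynamics -/

/-- A continuation argument: if smallness up to time `τ` always improves to better smallness, then a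
uniformly continuous function stays small. -/
theorem lt_of_bootstrap {f : ℝ → ℝ≥0∞} {L r δ : ℝ} (hr : 0 < r) (hδ : 0 < δ)
    (h0 : f 0 ≤ ENNReal.ofReal (r / 4))
    (hcont : ∀ s ∈ Ico 0 L, ∀ t ∈ Ico 0 L, |t - s| < δ → f t ≤ f s + ENNReal.ofReal (r / 4))
    (hstep : ∀ τ, 0 < τ → τ ≤ L → (∀ t ∈ Ico 0 τ, f t < ENNReal.ofReal r) →
      ∀ t ∈ Ico 0 τ, f t ≤ ENNReal.ofReal (r / 2)) :
    ∀ t ∈ Ico 0 L, f t < ENNReal.ofReal r := by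
  have hlt : ∀ x : ℝ≥0∞, x ≤ ENNReal.ofReal (r / 2) →
      x + ENNReal.ofReal (r / 4) < ENNReal.ofReal r := fun x hx => by
    refine (add_le_add_left hx _).trans_lt ?_
    rw [← ENNReal.ofReal_add (by positivity) (by positivity), ENNReal.ofReal_lt_ofReal_iff hr]
    linarith
  have key : ∀ n : ℕ, ∀ t ∈ Ico 0 L, t < (n + 1) * (δ / 2) → f t < ENNReal.ofReal r := by
    intro n
    induction n with
    | zero =>
      intro t ht htδ
      have h0L : (0 : ℝ) ∈ Ico 0 L := ⟨le_rfl, ht.1.trans_lt ht.2⟩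
      refine (hcont 0 h0L t ht ?_).trans_lt (hlt _ (h0.trans ?_))
      · rw [sub_zero, abs_of_nonneg ht.1]
        simp at htδ
        linarith
      · exact ENNReal.ofReal_le_ofReal (by linarith)
    | succ n ih =>
      intro t ht htδ
      rcases lt_or_ge t ((n + 1) * (δ / 2)) with h | h
      · exact ih t ht h
      · have hn : 0 < (n + 1 : ℝ) * (δ / 2) := by positivity
        have hn1 : (1 : ℝ) * (δ / 2) ≤ (n + 1 : ℝ) * (δ / 2) := by
          gcongr; simp
        push_cast at htδ
        have hs : t - δ / 2 ∈ Ico 0 (min L ((n + 1) * (δ / 2))) :=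
          ⟨by linarith, lt_min (by linarith [ht.2]) (by linarith)⟩
        have := hstep (min L ((n + 1) * (δ / 2))) (lt_min (ht.1.trans_lt ht.2) hn)
          (min_le_left _ _) (fun t' ht' => ih t' ⟨ht'.1, ht'.2.trans_le (min_le_left _ _)⟩
            (ht'.2.trans_le (min_le_right _ _))) _ hs
        refine (hcont (t - δ / 2) ⟨hs.1, by linarith [ht.2]⟩ t ht ?_).trans_lt (hlt _ this)
        rw [sub_sub_cancel, abs_of_pos (by positivity)]
        linarith
  intro t ht
  obtain ⟨n, hn⟩ := exists_nat_gt (t / (δ / 2))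
  rw [div_lt_iff₀ (by positivity)] at hn
  exact key n t ht (by nlinarith)

/-- The discrete dynamics near the manifold of equilibria. `Φ` assigns to a state `v₀` near `0`
an equilibrium with the same component in `N(A)`; during a time step of length `T`, the distance
to the assigned equilibrium is halved, and the assigned equilibrium moves by at most a multiple of
this distance. The set `M` is the manifold of equilibria before the shift by `u`. Solutions are
taken on `[0, 2T)`, so that consecutive ones overlap. -/
structure IsContractiveStep (E : FunctionSpacePair ι) (F : X1 → X0) (U₁ : Set X1) (u : X1)
    (M : Set X1) (T : ℝ) (Φ : X0 → X1) (C : ℝ≥0) (ρ : ℝ) : Prop where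
  time_pos : 0 < T
  radius_pos : 0 < ρ
  map_zero : Φ 0 = 0
  mem : ∀ x, gammaNorm E x < ENNReal.ofReal ρ → Φ x + u ∈ M
  lipschitz : ∀ x y, gammaNorm E x < ENNReal.ofReal ρ → gammaNorm E y < ENNReal.ofReal ρ →
    ‖Φ x - Φ y‖ₑ ≤ C * gammaNorm E (x - y)
  near : ∀ v₀ v V, gammaNorm E v₀ < ENNReal.ofReal ρ →
    SolvesShifted E F U₁ u (ENNReal.ofReal (2 * T)) v₀ v V → ∀ t ∈ Ico 0 (2 * T),
      gammaNorm E (V t - ι (Φ v₀)) ≤ C * gammaNorm E (v₀ - ι (Φ v₀))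
  contract : ∀ v₀ v V, gammaNorm E v₀ < ENNReal.ofReal ρ →
    SolvesShifted E F U₁ u (ENNReal.ofReal (2 * T)) v₀ v V →
      gammaNorm E (V T - ι (Φ (V T))) ≤ 2⁻¹ * gammaNorm E (v₀ - ι (Φ v₀))
  shift : ∀ v₀ v V, gammaNorm E v₀ < ENNReal.ofReal ρ →
    SolvesShifted E F U₁ u (ENNReal.ofReal (2 * T)) v₀ v V →
      ‖Φ (V T) - Φ v₀‖ₑ ≤ C * gammaNorm E (v₀ - ι (Φ v₀))

/-- Under the conditions for normal stability, the discrete dynamics contracts towards the manifold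
of equilibria, for a sufficiently long time step: the semigroup contributes a factor `1/4`, and the
perturbation by the nonlinearity another `1/4`. -/
theorem exists_isContractiveStep [CompleteSpace X0] [CompleteSpace X1]
    (hι : Function.Injective ι) {F : X1 → X0} {U₁ : Set X1} {u : X1} (hA : A = fderiv ℝ F u)
    {S : ℝ → X0 →L[ℝ] X0} (hS : GeneratesAnalytic ι A S)
    {m : ℕ} {U : Set (EuclideanSpace ℝ (Fin m))} {Ψ : EuclideanSpace ℝ (Fin m) → X1}
    (hM : IsEquilibriumManifold F U₁ u m U Ψ)
    (htangent : LinearMap.range (fderiv ℝ Ψ 0 : EuclideanSpace ℝ (Fin m) →ₗ[ℝ] X1)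
      = LinearMap.ker (A : X1 →ₗ[ℝ] X0))
    (hss : IsCompl (kerSpace ι A) (rangeSpace A)) {ω : ℝ} (hω : 0 < ω)
    {E : FunctionSpacePair ι} (h1 : CondA1 E) (h2 : CondA2 E ω) (h3 : CondA3 E A)
    (h4 : CondA4 E A S hss ω) (h5 : CondA5 E F U₁ u) :
    ∃ T Φ C ρ, IsContractiveStep E F U₁ u (Ψ '' U) T Φ C ρ := by
  obtain ⟨κ, hκ1, hκ2, hκ3, hκ4⟩ := exists_kernel_projection hι hss
  obtain ⟨Φ, CΦ, ρΦ, hρΦ, hΦ0, hΦ, hΦlip⟩ := hM.exists_graph htangent hκ1 hκ3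
  obtain ⟨M₁, hM₁⟩ := h4.exists_decay hω
  obtain ⟨cγ, hcγ⟩ := exists_gammaNorm_le E h1
  obtain ⟨cX, hcX⟩ := exists_enorm_le_gammaNorm E
  obtain ⟨C₁, hC₁⟩ := h5
  -- the semigroup contracts by the factor `1/4` on `R(A)` during the time `T`
  obtain ⟨T, hT, hTM⟩ : ∃ T : ℝ, 0 < T ∧ M₁ * Real.exp (-(ω * T)) ≤ 1 / 4 := by
    have : Tendsto (fun T : ℝ => (M₁ : ℝ) * Real.exp (-(ω * T))) atTop (𝓝 (M₁ * 0)) :=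
      (Real.tendsto_exp_neg_atTop_nhds_zero.comp (tendsto_id.const_mul_atTop hω)).const_mul _
    rw [mul_zero] at this
    obtain ⟨T, h1, h2⟩ := ((this.eventually (Iic_mem_nhds (by norm_num : (0 : ℝ) < 1 / 4))).and
      (eventually_gt_atTop 0)).exists
    exact ⟨T, h2, h1⟩
  obtain ⟨Cl, β₀, hβ₀, hlin⟩ :=
    exists_dist_semigroup_le hι hS hω h1 h2 h4 hκ1 hκ2 hκ3 hκ4 (2 * T)
  -- the smallness parameter for the perturbation
  set β : ℝ≥0 := min β₀ (4 * (Cl * (1 + cγ * CΦ) + 1))⁻¹ with hβdef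
  have hβ : 0 < β := by positivity
  have hβ1 : β ≤ β₀ := min_le_left _ _
  have hβ2 : Cl * β * (1 + cγ * CΦ) ≤ 4⁻¹ := by
    calc Cl * β * (1 + cγ * CΦ) = β * (Cl * (1 + cγ * CΦ)) := by ring
      _ ≤ (4 * (Cl * (1 + cγ * CΦ) + 1))⁻¹ * (Cl * (1 + cγ * CΦ) + 1) := by
        gcongr
        · exact min_le_right _ _
        · simp
      _ = 4⁻¹ := by field_simp
  have hβ3 : Cl * β ≤ 4⁻¹ := le_trans (le_mul_of_one_le_right' (by simp)) hβ2
  set D₁ : ℝ := |C₁| + 1 with hD₁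
  have hD₁pos : 0 < D₁ := by positivity
  obtain ⟨r₀, hr₀, hG⟩ := hC₁ (β / (2 * D₁)) (by positivity)
  set r : ℝ := min r₀ (ρΦ / (cX + 1)) with hr
  have hrpos : 0 < r := by positivity
  have hball : ∀ x, gammaNorm E x < ENNReal.ofReal r → ‖x‖ < ρΦ := by
    intro x hx
    have h : ‖x‖ₑ < ENNReal.ofReal ρΦ := by
      calc ‖x‖ₑ ≤ (cX + 1 : ℝ≥0) * gammaNorm E x :=
            (hcX x).trans (by gcongr; simp)
        _ < (cX + 1 : ℝ≥0) * ENNReal.ofReal (ρΦ / (cX + 1)) :=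
            ENNReal.mul_lt_mul_right (by positivity) ENNReal.coe_ne_top
              (hx.trans_le (ENNReal.ofReal_le_ofReal (min_le_right _ _)))
        _ = ENNReal.ofReal ρΦ := by
            rw [← ENNReal.ofReal_coe_nnreal, ← ENNReal.ofReal_mul (NNReal.coe_nonneg _)]
            congr 1
            push_cast
            field_simp
    rw [← ofReal_norm] at h
    exact (ENNReal.ofReal_lt_ofReal_iff hρΦ).1 h
  have hlipκ : ∀ x y, gammaNorm E x < ENNReal.ofReal r → gammaNorm E y < ENNReal.ofReal r →
      ‖Φ x - Φ y‖ₑ ≤ CΦ * ‖κ (x - y)‖ₑ := fun x y hx hy => by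
    have : ‖Φ x - Φ y‖₊ ≤ CΦ * ‖κ (x - y)‖₊ := hΦlip x y (hball x hx) (hball y hy)
    simpa [enorm_eq_nnnorm] using ENNReal.coe_le_coe.2 this
  set C₂ : ℝ≥0 := CΦ * (‖κ‖₊ * cX) with hC₂
  have hlipγ : ∀ x y, gammaNorm E x < ENNReal.ofReal r → gammaNorm E y < ENNReal.ofReal r →
      ‖Φ x - Φ y‖ₑ ≤ C₂ * gammaNorm E (x - y) := fun x y hx hy => by
    refine (hlipκ x y hx hy).trans ?_
    rw [hC₂, ENNReal.coe_mul, ENNReal.coe_mul, mul_assoc, mul_assoc]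
    gcongr
    exact (κ.le_opENorm _).trans (by rw [enorm_eq_nnnorm]; gcongr; exact hcX _)
  set B : ℝ≥0 := cγ * C₂ + (M₁ + 1) * (1 + cγ * C₂) + 1 with hB
  set ρ : ℝ := min (r / (4 * B)) (β / (2 * D₁ * (C₂ + 1))) with hρ
  have hB1 : (1 : ℝ) ≤ B := by
    have : (1 : ℝ≥0) ≤ B := le_add_self
    exact_mod_cast this
  have hBpos : (0 : ℝ) < B := by linarith
  have hρpos : 0 < ρ := by
    have : (0 : ℝ) < β := hβ
    positivity
  have hBρ : ∀ x, gammaNorm E x < ENNReal.ofReal ρ → B * gammaNorm E x ≤ ENNReal.ofReal (r / 4) := by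
    intro x hx
    calc B * gammaNorm E x ≤ B * ENNReal.ofReal (r / (4 * B)) := by
          gcongr
          exact hx.le.trans (ENNReal.ofReal_le_ofReal (min_le_left _ _))
      _ = ENNReal.ofReal (r / 4) := by
          rw [← ENNReal.ofReal_coe_nnreal, ← ENNReal.ofReal_mul (NNReal.coe_nonneg _)]
          congr 1
          field_simp
  have hlt : ENNReal.ofReal (r / 4) < ENNReal.ofReal r := by
    rw [ENNReal.ofReal_lt_ofReal_iff hrpos]; linarith
  have hB1' : (1 : ℝ≥0∞) ≤ B := by exact_mod_cast hB1
  have hle4 : ∀ x, gammaNorm E x < ENNReal.ofReal ρ → gammaNorm E x ≤ ENNReal.ofReal (r / 4) :=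
    fun x hx => (le_mul_of_one_le_left' hB1').trans (hBρ x hx)
  have hρr : ∀ x, gammaNorm E x < ENNReal.ofReal ρ → gammaNorm E x < ENNReal.ofReal r :=
    fun x hx => (hle4 x hx).trans_lt hlt
  have h0r : gammaNorm E 0 < ENNReal.ofReal r := by
    have := hcγ 0
    simp only [map_zero, enorm_zero, mul_zero, nonpos_iff_eq_zero] at this
    rw [this]
    simpa using hrpos
  -- the bounds for a solution on `[0, 2T)` that starts close to `0`
  have main : ∀ v₀ v V, gammaNorm E v₀ < ENNReal.ofReal ρ →
      SolvesShifted E F U₁ u (ENNReal.ofReal (2 * T)) v₀ v V → ∀ t ∈ Ico 0 (2 * T),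
        gammaNorm E (V t) < ENNReal.ofReal r ∧
        gammaNorm E (V t - ι (Φ v₀)) ≤
          ENNReal.ofReal (M₁ * Real.exp (-(ω * t))) * gammaNorm E (v₀ - ι (Φ v₀)) +
            Cl * β * gammaNorm E (v₀ - ι (Φ v₀)) ∧
        gammaNorm E (V t - ι (Φ v₀)) ≤ (M₁ + 1 : ℝ≥0) * gammaNorm E (v₀ - ι (Φ v₀)) ∧
        ‖κ (V t - v₀)‖ₑ ≤ Cl * β * gammaNorm E (v₀ - ι (Φ v₀)) := by
    intro v₀ v V hv₀ hsol
    set e := Φ v₀ with he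
    set y := v₀ - ι e with hy
    have hv₀r := hρr v₀ hv₀
    have hen : ‖e‖ₑ ≤ C₂ * gammaNorm E v₀ := by
      simpa [hΦ0, ← he] using hlipγ v₀ 0 hv₀r h0r
    have heγ : gammaNorm E (ι e) ≤ cγ * C₂ * gammaNorm E v₀ := by
      refine (hcγ e).trans ?_
      rw [mul_assoc]
      gcongr
    have hyγ : gammaNorm E y ≤ (1 + cγ * C₂) * gammaNorm E v₀ := by
      refine (gammaNorm_sub_le E _ _).trans ?_
      rw [add_mul, one_mul]
      gcongr
    have heB : gammaNorm E (ι e) < ENNReal.ofReal r := by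
      refine lt_of_le_of_lt (heγ.trans ?_) ((hBρ v₀ hv₀).trans_lt hlt)
      gcongr
      rw [hB, ← ENNReal.coe_mul]
      exact ENNReal.coe_le_coe.2 (by rw [add_assoc]; exact le_self_add)
    have hereal : ‖e‖ ≤ β / (2 * D₁) := by
      have h : ‖e‖ₑ ≤ ENNReal.ofReal (β / (2 * D₁)) := by
        calc ‖e‖ₑ ≤ (C₂ + 1 : ℝ≥0) * ENNReal.ofReal (β / (2 * D₁ * (C₂ + 1))) := by
              refine hen.trans ?_
              gcongr
              · simp
              · exact hv₀.le.trans (ENNReal.ofReal_le_ofReal (min_le_right _ _))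
          _ = _ := by
              rw [← ENNReal.ofReal_coe_nnreal, ← ENNReal.ofReal_mul (NNReal.coe_nonneg _)]
              congr 1
              push_cast
              field_simp
      rw [← ofReal_norm] at h
      exact (ENNReal.ofReal_le_ofReal_iff (by positivity)).1 h
    obtain ⟨ζ, hζ, hζe⟩ := (hΦ v₀ (hball v₀ hv₀r)).1
    have heU : e + u ∈ U₁ ∧ F (e + u) = 0 := by
      have := hM.equilibria ζ hζ
      rwa [hζe] at this
    have hκy : κ y = 0 := by
      rw [hy, map_sub, (hΦ v₀ (hball v₀ hv₀r)).2, sub_self]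
    have hPy : stableProj ι A hss y = y := by rw [hκ4, hκy, map_zero, sub_zero]
    have hyfin : gammaNorm E y < ∞ :=
      hyγ.trans_lt (ENNReal.mul_lt_top (by finiteness) (hv₀.trans ENNReal.ofReal_lt_top))
    have hV0 : V 0 - ι e = y := by rw [hsol.init]
    have key : ∀ τ, 0 < τ → τ ≤ 2 * T → (∀ t ∈ Ico 0 τ, gammaNorm E (V t) < ENNReal.ofReal r) →
        ∀ t ∈ Ico 0 τ, gammaNorm E (V t - ι e - S t y) ≤ Cl * β * gammaNorm E y ∧
          ‖κ (V t - ι e)‖ₑ ≤ Cl * β * gammaNorm E y := by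
      intro τ hτ hτT hsmall t ht
      have hsolτ := hsol.mono (ENNReal.ofReal_le_ofReal hτT)
      obtain ⟨hw, H, hg⟩ := hsolτ.sub_equilibrium hA h3 hτ heU.2
      rw [← timeInterval_ofReal] at ht
      have := hlin β hβ1 τ hτ hτT _ _ _ hw H hg (by rw [hV0, hκy]) ?_ t ht
      · simpa only [hV0] using this
      · filter_upwards [hsolτ.dom, hsolτ.eqn.ae_eq,
          ae_restrict_mem (measurableSet_timeInterval _)] with s hs1 hs2 hs3
        rw [timeInterval_ofReal] at hs3
        have hrr : ENNReal.ofReal r ≤ ENNReal.ofReal r₀ :=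
          ENNReal.ofReal_le_ofReal (min_le_left _ _)
        refine (hG (v s) e hs1 heU.1 (by rw [hs2]; exact (hsmall s hs3).trans_le hrr)
          (heB.trans_le hrr)).trans ?_
        gcongr
        calc C₁ * (β / (2 * D₁) + ‖e‖) ≤ D₁ * (β / (2 * D₁) + β / (2 * D₁)) := by
              gcongr
              exact (le_abs_self C₁).trans (by linarith)
          _ = β := by field_simp; norm_num
    have key' : ∀ τ, 0 < τ → τ ≤ 2 * T → (∀ t ∈ Ico 0 τ, gammaNorm E (V t) < ENNReal.ofReal r) →
        ∀ t ∈ Ico 0 τ, gammaNorm E (V t - ι e) ≤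
          ENNReal.ofReal (M₁ * Real.exp (-(ω * t))) * gammaNorm E y + Cl * β * gammaNorm E y ∧
          gammaNorm E (V t - ι e) ≤ (M₁ + 1 : ℝ≥0) * gammaNorm E y := by
      intro τ hτ hτT hsmall t ht
      have hle : gammaNorm E (V t - ι e) ≤
          ENNReal.ofReal (M₁ * Real.exp (-(ω * t))) * gammaNorm E y + Cl * β * gammaNorm E y := by
        rw [← add_sub_cancel (S t y) (V t - ι e)]
        exact (gammaNorm_add_le E _ _).trans
          (add_le_add (hM₁ t ht.1 y hyfin hPy) (key τ hτ hτT hsmall t ht).1)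
      refine ⟨hle, hle.trans ?_⟩
      rw [← add_mul, ENNReal.coe_add]
      gcongr
      · rw [← ENNReal.ofReal_coe_nnreal]
        refine ENNReal.ofReal_le_ofReal (mul_le_of_le_one_right M₁.coe_nonneg ?_)
        rw [Real.exp_le_one_iff]
        have := mul_nonneg hω.le ht.1
        linarith
      · rw [← ENNReal.coe_mul]
        exact ENNReal.coe_le_coe.2 (hβ3.trans (by rw [← NNReal.coe_le_coe]; norm_num))
    have hsmall : ∀ t ∈ Ico 0 (2 * T), gammaNorm E (V t) < ENNReal.ofReal r := by
      obtain ⟨δ, hδ, hcont⟩ := h1.unifCont (ENNReal.ofReal (2 * T)) (by simpa using hT) v V _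
        hsol.mem hsol.eqn (r / 4) (by positivity)
      rw [timeInterval_ofReal] at hcont
      refine lt_of_bootstrap hrpos hδ ?_ (fun s hs t ht hst => ?_) fun τ hτ hτT hsm t ht => ?_
      · rw [hsol.init]
        exact hle4 v₀ hv₀
      · rw [← add_sub_cancel (V s) (V t)]
        exact (gammaNorm_add_le E _ _).trans (add_le_add_right (hcont s hs t ht hst) _)
      · calc gammaNorm E (V t) = gammaNorm E (ι e + (V t - ι e)) := by rw [add_sub_cancel]
          _ ≤ cγ * C₂ * gammaNorm E v₀ +
              (M₁ + 1 : ℝ≥0) * ((1 + cγ * C₂) * gammaNorm E v₀) := by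
            refine (gammaNorm_add_le E _ _).trans (add_le_add heγ ?_)
            exact (key' τ hτ hτT hsm t ht).2.trans (by gcongr)
          _ = (cγ * C₂ + (M₁ + 1) * (1 + cγ * C₂) : ℝ≥0) * gammaNorm E v₀ := by
            push_cast; ring
          _ ≤ B * gammaNorm E v₀ := by
            gcongr
            exact le_self_add
          _ ≤ ENNReal.ofReal (r / 2) :=
            (hBρ v₀ hv₀).trans (ENNReal.ofReal_le_ofReal (by linarith))
    intro t ht
    have h2T : 0 < 2 * T := by positivity
    have e1 : κ (V t - v₀) = κ (V t - ι e) := by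
      have : V t - v₀ = V t - ι e - y := by rw [hy]; abel
      rw [this, map_sub, hκy, sub_zero]
    exact ⟨hsmall t ht, (key' _ h2T le_rfl hsmall t ht).1, (key' _ h2T le_rfl hsmall t ht).2,
      by rw [e1]; exact (key _ h2T le_rfl hsmall t ht).2⟩
  have hT2 : T ∈ Ico 0 (2 * T) := ⟨hT.le, by linarith⟩
  have hstep : ∀ v₀ v V, gammaNorm E v₀ < ENNReal.ofReal ρ →
      SolvesShifted E F U₁ u (ENNReal.ofReal (2 * T)) v₀ v V →
      ‖Φ (V T) - Φ v₀‖ₑ ≤ CΦ * (Cl * β) * gammaNorm E (v₀ - ι (Φ v₀)) := by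
    intro v₀ v V hv₀ hsol
    have h := main v₀ v V hv₀ hsol T hT2
    refine (hlipκ _ _ h.1 (hρr v₀ hv₀)).trans ?_
    rw [mul_assoc]
    gcongr
    exact h.2.2.2
  refine ⟨T, Φ, C₂ + (M₁ + 1) + CΦ * (Cl * β), ρ, hT, hρpos, hΦ0,
    fun x hx => (hΦ x (hball x (hρr x hx))).1, fun x y hx hy => ?_, fun v₀ v V hv₀ hsol t ht => ?_,
    fun v₀ v V hv₀ hsol => ?_, fun v₀ v V hv₀ hsol => ?_⟩
  · refine (hlipγ x y (hρr x hx) (hρr y hy)).trans ?_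
    gcongr ?_ * _
    refine ENNReal.coe_le_coe.2 ?_
    rw [add_assoc]
    exact le_self_add
  · refine (main v₀ v V hv₀ hsol t ht).2.2.1.trans ?_
    gcongr ?_ * _
    exact ENNReal.coe_le_coe.2 (le_add_self.trans le_self_add)
  · have hsplit : V T - ι (Φ (V T)) = (V T - ι (Φ v₀)) - ι (Φ (V T) - Φ v₀) := by
      rw [map_sub]; abel
    rw [hsplit]
    refine (gammaNorm_sub_le E _ _).trans ((add_le_add (main v₀ v V hv₀ hsol T hT2).2.1
      ((hcγ _).trans (mul_le_mul_right (hstep v₀ v V hv₀ hsol) _))).trans ?_)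
    set Y := gammaNorm E (v₀ - ι (Φ v₀))
    have h4 : ENNReal.ofReal (M₁ * Real.exp (-(ω * T))) ≤ (4⁻¹ : ℝ≥0) := by
      rw [← ENNReal.ofReal_coe_nnreal]
      refine ENNReal.ofReal_le_ofReal (hTM.trans ?_)
      norm_num
    calc _ ≤ (4⁻¹ : ℝ≥0) * Y + Cl * β * Y + cγ * (CΦ * (Cl * β) * Y) := by gcongr
      _ = (4⁻¹ : ℝ≥0) * Y + (Cl * β * (1 + cγ * CΦ) : ℝ≥0) * Y := by push_cast; ring
      _ ≤ (4⁻¹ : ℝ≥0) * Y + (4⁻¹ : ℝ≥0) * Y := by gcongr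
      _ = ((4⁻¹ + 4⁻¹ : ℝ≥0) : ℝ≥0∞) * Y := by push_cast; ring
      _ = 2⁻¹ * Y := by
        have : (4⁻¹ + 4⁻¹ : ℝ≥0) = 2⁻¹ := by
          rw [← NNReal.coe_inj]; norm_num
        rw [this]
        simp
  · refine (hstep v₀ v V hv₀ hsol).trans ?_
    rw [← ENNReal.coe_mul, ← ENNReal.coe_mul]
    gcongr ?_ * _
    exact ENNReal.coe_le_coe.2 le_add_self

end

section

variable {X0 X1 : Type*} [NormedAddCommGroup X0] [NormedSpace ℝ X0]
  [NormedAddCommGroup X1] [NormedSpace ℝ X1] {ι : X1 →L[ℝ] X0}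

/-! ### Global solutions -/

section

variable {E : FunctionSpacePair ι} {F : X1 → X0} {U₁ : Set X1} {u : X1} {T : ℝ}

/-- Solutions on `[0, 2T)` whose initial values are the values of their predecessors at time `T`
can be concatenated to a global solution, provided that uniqueness on `[0, T)` makes them agree
on their overlaps. -/
theorem exists_global_of_steps (hT : 0 < T) {x : ℕ → X0} {v : ℕ → ℝ → X1} {V : ℕ → ℝ → X0}
    (hsol : ∀ n, SolvesShifted E F U₁ u (ENNReal.ofReal (2 * T)) (x n) (v n) (V n))
    (hnext : ∀ n, x (n + 1) = V n T)
    (huniq : ∀ n, ∀ z Z z' Z', SolvesShifted E F U₁ u (ENNReal.ofReal T) (x n) z Z →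
      SolvesShifted E F U₁ u (ENNReal.ofReal T) (x n) z' Z' →
        z =ᵐ[volume.restrict (timeInterval (ENNReal.ofReal T))] z' ∧
          EqOn Z Z' (timeInterval (ENNReal.ofReal T))) :
    ∃ w W, (∀ t, 0 < t → SolvesShifted E F U₁ u (ENNReal.ofReal t) (x 0) w W) ∧
      ∀ n : ℕ, ∀ s ∈ Ico 0 T, W (s + n * T) = V n s := by
  set w : ℝ → X1 := fun t => v ⌊t / T⌋₊ (t - ⌊t / T⌋₊ * T) with hw
  set W : ℝ → X0 := fun t => V ⌊t / T⌋₊ (t - ⌊t / T⌋₊ * T) with hW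
  have hfloor : ∀ n : ℕ, ∀ s ∈ Ico 0 T, ⌊(s + n * T) / T⌋₊ = n := by
    intro n s hs
    rw [add_div, mul_div_cancel_right₀ _ hT.ne', Nat.floor_add_natCast (div_nonneg hs.1 hT.le),
      Nat.floor_eq_zero.2 ((div_lt_one hT).2 hs.2), zero_add]
  have hwn : ∀ n : ℕ, ∀ s ∈ Ico 0 T, w (s + n * T) = v n s := by
    intro n s hs
    simp only [hw]
    rw [hfloor n s hs, add_sub_cancel_right]
  have hWn : ∀ n : ℕ, ∀ s ∈ Ico 0 T, W (s + n * T) = V n s := by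
    intro n s hs
    simp only [hW]
    rw [hfloor n s hs, add_sub_cancel_right]
  have hT2 : T < 2 * T := by linarith
  -- consecutive pieces agree on their overlap
  have hoverlap : ∀ n, (fun t => v n (t + T))
        =ᵐ[volume.restrict (timeInterval (ENNReal.ofReal T))] v (n + 1) ∧
      EqOn (fun t => V n (t + T)) (V (n + 1)) (timeInterval (ENNReal.ofReal T)) := by
    intro n
    refine huniq (n + 1) _ _ _ _ ?_ ((hsol (n + 1)).mono (ENNReal.ofReal_le_ofReal hT2.le))
    have := (hsol n).translate hT.le hT2
    rwa [← hnext, two_mul, add_sub_cancel_right] at this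
  have hshift : ∀ n : ℕ, SolvesShifted E F U₁ u (ENNReal.ofReal (2 * T)) (x n)
      (fun t => w (t + n * T)) (fun t => W (t + n * T)) := by
    intro n
    refine (hsol n).congr_ae (by simpa using hT) ?_ ?_
    · have hsub : timeInterval (ENNReal.ofReal (2 * T)) ⊆ Ico 0 T ∪
          (fun t => t + -T) ⁻¹' timeInterval (ENNReal.ofReal T) := by
        intro t ht
        simp only [timeInterval_ofReal, mem_union, mem_preimage, mem_Ico] at ht ⊢
        rcases lt_or_ge t T with hst | hst
        · exact Or.inl ⟨ht.1, hst⟩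
        · exact Or.inr ⟨by linarith, by linarith⟩
      refine ae_restrict_of_ae_restrict_of_subset hsub ?_
      rw [ae_restrict_union_iff]
      constructor
      · filter_upwards [ae_restrict_mem measurableSet_Ico] with t ht using hwn n t ht
      · have h := ae_comp_add_right (c := -T) ((hoverlap n).1.and
          (ae_restrict_mem (measurableSet_timeInterval _)))
        filter_upwards [h] with t ht
        rw [timeInterval_ofReal] at ht
        have h2 := hwn (n + 1) _ ht.2
        have h1 := ht.1
        simp only [neg_add_cancel_right] at h1
        rw [h1, ← h2]
        congr 1
        push_cast
        ring
    · intro t ht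
      rw [timeInterval_ofReal] at ht
      rcases lt_or_ge t T with hst | hst
      · exact hWn n t ⟨ht.1, hst⟩
      · have hmem : t - T ∈ Ico 0 T := ⟨by linarith, by linarith [ht.2]⟩
        have h1 := (hoverlap n).2 (by rw [timeInterval_ofReal]; exact hmem)
        have h2 := hWn (n + 1) _ hmem
        simp only [sub_add_cancel] at h1
        rw [h1, ← h2]
        simp only
        congr 1
        push_cast
        ring
  have hglobal : ∀ n : ℕ,
      SolvesShifted E F U₁ u (ENNReal.ofReal ((n + 2) * T)) (x 0) w W := by
    intro n
    induction n with
    | zero => simpa using hshift 0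
    | succ n ih =>
      have hs : ((n + 1 : ℕ) : ℝ) * T = (n + 2) * T - T := by push_cast; ring
      have hx : W ((n + 1 : ℕ) * T) = x (n + 1) := by
        have := (hshift (n + 1)).init
        simpa using this
      have h := ih.glue (s := (n + 1 : ℕ) * T) (T := 2 * T) (by positivity) (by linarith)
        (by linarith) (by rw [hx]; exact hshift (n + 1))
      convert h using 2
      push_cast
      ring
  refine ⟨w, W, fun t ht => ?_, hWn⟩
  obtain ⟨n, hn⟩ := exists_nat_gt (t / T)
  rw [div_lt_iff₀ hT] at hn
  exact (hglobal n).mono (ENNReal.ofReal_le_ofReal (by nlinarith))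

/-- A global solution takes the values of the steps, if these are unique. -/
theorem eq_of_steps (hT : 0 < T) {x : ℕ → X0} {v : ℕ → ℝ → X1} {V : ℕ → ℝ → X0}
    (hsol : ∀ n, SolvesShifted E F U₁ u (ENNReal.ofReal (2 * T)) (x n) (v n) (V n))
    (hnext : ∀ n, x (n + 1) = V n T)
    (huniq : ∀ n, ∀ z Z z' Z', SolvesShifted E F U₁ u (ENNReal.ofReal (2 * T)) (x n) z Z →
      SolvesShifted E F U₁ u (ENNReal.ofReal (2 * T)) (x n) z' Z' →
        z =ᵐ[volume.restrict (timeInterval (ENNReal.ofReal (2 * T)))] z' ∧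
          EqOn Z Z' (timeInterval (ENNReal.ofReal (2 * T))))
    {w : ℝ → X1} {W : ℝ → X0}
    (hw : ∀ t, 0 < t → SolvesShifted E F U₁ u (ENNReal.ofReal t) (x 0) w W) (n : ℕ) :
    ∀ s ∈ Ico 0 (2 * T), W (s + n * T) = V n s := by
  have hpiece : ∀ n : ℕ, W (n * T) = x n → ∀ s ∈ Ico 0 (2 * T), W (s + n * T) = V n s := by
    intro n hn s hs
    have h := (hw (n * T + 2 * T) (by positivity)).translate (s := n * T) (by positivity)
      (by linarith)
    rw [add_sub_cancel_left, hn] at h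
    rw [← timeInterval_ofReal] at hs
    exact (huniq n _ _ _ _ h (hsol n)).2 hs
  refine hpiece n ?_
  induction n with
  | zero => simpa using (hw T hT).init
  | succ n ih =>
    have := hpiece n ih T ⟨hT.le, by linarith⟩
    rw [hnext, ← this]
    congr 1
    push_cast
    ring

/-- Stability of `0` and exponential convergence to equilibria, for the shifted equation. -/
theorem IsContractiveStep.exists_stable [CompleteSpace X1] (h1 : CondA1 E)
    (h6 : CondA6 E F U₁ u) {M : Set X1} {Φ : X0 → X1} {C : ℝ≥0} {ρ : ℝ}
    (H : IsContractiveStep E F U₁ u M T Φ C ρ) :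
    ∃ δ : ℝ, 0 < δ ∧ ∃ B : ℝ≥0, ∃ α : ℝ, 0 < α ∧ ∃ K : ℝ,
      ∀ v₀ : X0, gammaNorm E v₀ < ENNReal.ofReal δ →
        ∃ v V, (∀ t, 0 < t → SolvesShifted E F U₁ u (ENNReal.ofReal t) v₀ v V) ∧
          (∀ v' V', (∀ t, 0 < t → SolvesShifted E F U₁ u (ENNReal.ofReal t) v₀ v' V') →
            ∀ t, 0 ≤ t → V' t = V t) ∧
          (∀ t, 0 ≤ t → gammaNorm E (V t) ≤ B * gammaNorm E v₀) ∧
          ∃ e, e + u ∈ M ∧ ∀ t, 0 ≤ t →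
            gammaNorm E (V t - ι e) ≤ ENNReal.ofReal (K * Real.exp (-α * t)) := by
  have hT := H.time_pos
  obtain ⟨cγ, hcγ⟩ := exists_gammaNorm_le E h1
  obtain ⟨rT, hrT, huniqT⟩ := h6.exists_unique hT
  obtain ⟨rL, hrL, huniqL⟩ := h6.exists_unique (b := 2 * T) (by positivity)
  set r := min (ρ / 2) (min rT rL) with hr
  have hrpos : 0 < r := by
    have := H.radius_pos
    positivity
  -- all iterates are bounded by `B γ(v₀)`
  set D : ℝ≥0 := 1 + cγ * C with hD
  set B : ℝ≥0 := (1 + C) * D + cγ * (C + 2 * C * D) with hB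
  have hD1 : 1 ≤ D := le_self_add
  have hB1 : 1 ≤ B := by
    calc (1 : ℝ≥0) ≤ 1 * 1 := by simp
      _ ≤ (1 + C) * D := by gcongr; exact le_self_add
      _ ≤ B := le_self_add
  set δ := r / B with hδ
  have hδpos : 0 < δ := div_pos hrpos (lt_of_lt_of_le one_pos (by exact_mod_cast hB1))
  set Q : ℝ := C * (D * δ) with hQ
  set K : ℝ := 2 * (C * (D * δ) + cγ * (2 * Q)) with hK
  refine ⟨δ, hδpos, B, Real.log 2 / T, div_pos (Real.log_pos one_lt_two) hT, K,
    fun v₀ hv₀ => ?_⟩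
  set Y := gammaNorm E v₀ with hY
  have hBpos : (0 : ℝ) < B := lt_of_lt_of_le one_pos (by exact_mod_cast hB1)
  have hBr : B * Y < ENNReal.ofReal r := by
    calc B * Y < B * ENNReal.ofReal δ :=
          ENNReal.mul_lt_mul_right (by simpa using (one_pos.trans_le hB1).ne')
            ENNReal.coe_ne_top hv₀
      _ = ENNReal.ofReal r := by
          rw [← ENNReal.ofReal_coe_nnreal, ← ENNReal.ofReal_mul (NNReal.coe_nonneg _), hδ,
            mul_div_cancel₀ _ hBpos.ne']
  have hrρ : ENNReal.ofReal r ≤ ENNReal.ofReal (ρ / 2) :=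
    ENNReal.ofReal_le_ofReal (min_le_left _ _)
  have hρ2 : ENNReal.ofReal (ρ / 2) ≤ ENNReal.ofReal ρ :=
    ENNReal.ofReal_le_ofReal (by linarith [H.radius_pos])
  have hr1 : ENNReal.ofReal r ≤ ENNReal.ofReal rT :=
    ENNReal.ofReal_le_ofReal ((min_le_right _ _).trans (min_le_left _ _))
  have hr2 : ENNReal.ofReal r ≤ ENNReal.ofReal rL :=
    ENNReal.ofReal_le_ofReal ((min_le_right _ _).trans (min_le_right _ _))
  have hYr : Y < ENNReal.ofReal r :=
    (le_mul_of_one_le_left' (by exact_mod_cast hB1)).trans_lt hBr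
  have h0 : gammaNorm E (0 : X0) = 0 := by simpa using hcγ 0
  have hΦv₀ : ‖Φ v₀‖ₑ ≤ C * Y := by
    simpa [H.map_zero] using H.lipschitz v₀ 0 (hYr.trans_le (hrρ.trans hρ2))
      (by rw [h0]; simpa using H.radius_pos)
  -- the sequence of the states at the times `n T`
  have hex : ∀ y, ∃ p : (ℝ → X1) × (ℝ → X0), gammaNorm E y < ENNReal.ofReal r →
      SolvesShifted E F U₁ u (ENNReal.ofReal (2 * T)) y p.1 p.2 := by
    intro y
    by_cases hy : gammaNorm E y < ENNReal.ofReal r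
    · obtain ⟨⟨v, V, h⟩, -⟩ := huniqL y (hy.trans_le hr2)
      exact ⟨(v, V), fun _ => h⟩
    · exact ⟨0, fun h => absurd h hy⟩
  choose p hp using hex
  let x : ℕ → X0 := fun n => Nat.rec v₀ (fun _ y => (p y).2 T) n
  have hx0 : x 0 = v₀ := rfl
  have hxs : ∀ n, x (n + 1) = (p (x n)).2 T := fun n => rfl
  have hT2 : T ∈ Ico 0 (2 * T) := ⟨hT.le, by linarith⟩
  -- bounds during one step, from the bounds at its beginning
  have hbound : ∀ n, gammaNorm E (x n) ≤ B * Y →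
      gammaNorm E (x n - ι (Φ (x n))) ≤ D * Y → ‖Φ (x n) - Φ v₀‖ₑ ≤ 2 * C * (D * Y) →
      ∀ t ∈ Ico 0 (2 * T), gammaNorm E ((p (x n)).2 t) ≤ B * Y := by
    intro n hn1 hn2 hn3 t ht
    have hnr := hn1.trans_lt hBr
    have h1 := H.near _ _ _ (hnr.trans_le (hrρ.trans hρ2)) (hp _ hnr) t ht
    have h2 : ‖Φ (x n)‖ₑ ≤ C * Y + 2 * C * (D * Y) := by
      calc ‖Φ (x n)‖ₑ = ‖Φ v₀ + (Φ (x n) - Φ v₀)‖ₑ := by rw [add_sub_cancel]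
        _ ≤ _ := (enorm_add_le _ _).trans (add_le_add hΦv₀ hn3)
    calc gammaNorm E ((p (x n)).2 t)
        = gammaNorm E ((p (x n)).2 t - ι (Φ (x n)) + ι (Φ (x n))) := by rw [sub_add_cancel]
      _ ≤ C * (D * Y) + cγ * (C * Y + 2 * C * (D * Y)) := by
        refine (gammaNorm_add_le E _ _).trans (add_le_add (h1.trans (by gcongr)) ?_)
        exact (hcγ _).trans (by gcongr)
      _ = (C * D + cγ * (C + 2 * C * D) : ℝ≥0) * Y := by push_cast; ring
      _ ≤ B * Y := by
        gcongr
        rw [hB]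
        gcongr
        exact le_add_self
  have h2inv : ∀ n : ℕ, (2 : ℝ≥0∞)⁻¹ ^ n ≤ 1 := fun n =>
    pow_le_one₀ (by simp) (ENNReal.inv_le_one.2 one_le_two)
  have hinv : ∀ n, gammaNorm E (x n) ≤ B * Y ∧
      gammaNorm E (x n - ι (Φ (x n))) ≤ 2⁻¹ ^ n * (D * Y) ∧
      ‖Φ (x n) - Φ v₀‖ₑ + 2 * C * (2⁻¹ ^ n * (D * Y)) ≤ 2 * C * (D * Y) := by
    intro n
    induction n with
    | zero =>
      refine ⟨?_, ?_, ?_⟩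
      · exact le_mul_of_one_le_left' (by exact_mod_cast hB1)
      · rw [hx0, pow_zero, one_mul]
        refine (gammaNorm_sub_le E _ _).trans ?_
        calc _ ≤ Y + cγ * (C * Y) := by gcongr; exact (hcγ _).trans (by gcongr)
          _ = D * Y := by rw [hD]; push_cast; ring
      · simp [hx0]
    | succ n ih =>
      obtain ⟨i1, i2, i3⟩ := ih
      have i2' : gammaNorm E (x n - ι (Φ (x n))) ≤ D * Y :=
        i2.trans (mul_le_of_le_one_left' (h2inv n))
      have hnr := i1.trans_lt hBr
      have hnρ := hnr.trans_le (hrρ.trans hρ2)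
      refine ⟨hbound n i1 i2' (le_self_add.trans i3) T hT2, ?_, ?_⟩
      · refine (H.contract _ _ _ hnρ (hp _ hnr)).trans ?_
        rw [pow_succ', mul_assoc]
        gcongr
      · have hsh := H.shift _ _ _ hnρ (hp _ hnr)
        rw [← hxs] at hsh
        have e1 : (2 : ℝ≥0∞) * C * (2⁻¹ ^ (n + 1) * (D * Y)) = C * (2⁻¹ ^ n * (D * Y)) := by
          rw [pow_succ]
          calc _ = (2 * 2⁻¹ : ℝ≥0∞) * (C * (2⁻¹ ^ n * (D * Y))) := by ring
            _ = _ := by rw [ENNReal.mul_inv_cancel two_ne_zero ENNReal.ofNat_ne_top, one_mul]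
        calc _ ≤ (‖Φ (x (n + 1)) - Φ (x n)‖ₑ + ‖Φ (x n) - Φ v₀‖ₑ) + C * (2⁻¹ ^ n * (D * Y)) := by
              rw [e1]
              gcongr
              rw [← sub_add_sub_cancel (Φ (x (n + 1))) (Φ (x n)) (Φ v₀)]
              exact enorm_add_le _ _
          _ ≤ (C * (2⁻¹ ^ n * (D * Y)) + ‖Φ (x n) - Φ v₀‖ₑ) + C * (2⁻¹ ^ n * (D * Y)) := by
              gcongr
              exact hsh.trans (by gcongr)
          _ = ‖Φ (x n) - Φ v₀‖ₑ + 2 * C * (2⁻¹ ^ n * (D * Y)) := by ring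
          _ ≤ _ := i3
  have hxr : ∀ n, gammaNorm E (x n) < ENNReal.ofReal r := fun n => (hinv n).1.trans_lt hBr
  have hxρ : ∀ n, gammaNorm E (x n) < ENNReal.ofReal ρ :=
    fun n => (hxr n).trans_le (hrρ.trans hρ2)
  have hsol := fun n => hp (x n) (hxr n)
  obtain ⟨w, W, hw, hWn⟩ := exists_global_of_steps hT hsol hxs
    (fun n => (huniqT (x n) ((hxr n).trans_le hr1)).2)
  have huniq2 := fun n => (huniqL (x n) ((hxr n).trans_le hr2)).2
  -- every time is of the form `s + n T` with `0 ≤ s < T`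
  have htime : ∀ t : ℝ, 0 ≤ t → ∃ n : ℕ, ∃ s ∈ Ico 0 T, t = s + n * T := by
    intro t ht
    refine ⟨⌊t / T⌋₊, t - ⌊t / T⌋₊ * T, ⟨?_, ?_⟩, by ring⟩
    · have := Nat.floor_le (div_nonneg ht hT.le)
      rw [le_div_iff₀ hT] at this
      linarith
    · have := Nat.lt_floor_add_one (t / T)
      rw [div_lt_iff₀ hT] at this
      linarith
  have hIco : ∀ s ∈ Ico 0 T, s ∈ Ico 0 (2 * T) := fun s hs => ⟨hs.1, by linarith [hs.2]⟩
  refine ⟨w, W, hw, fun v' V' h' t ht => ?_, fun t ht => ?_, ?_⟩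
  · obtain ⟨n, s, hs, rfl⟩ := htime t ht
    rw [hWn n s hs]
    exact eq_of_steps hT hsol hxs huniq2 h' n s (hIco s hs)
  · obtain ⟨n, s, hs, rfl⟩ := htime t ht
    rw [hWn n s hs]
    exact hbound n (hinv n).1 ((hinv n).2.1.trans (mul_le_of_le_one_left' (h2inv n)))
      (le_self_add.trans (hinv n).2.2) s (hIco s hs)
  -- convergence of the assigned equilibria
  have hQ0 : 0 ≤ Q := by positivity
  have hhalf : ∀ n : ℕ, (2⁻¹ : ℝ≥0∞) ^ n = ENNReal.ofReal ((1 / 2) ^ n) := fun n => by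
    rw [ENNReal.ofReal_pow (by norm_num), one_div, ENNReal.ofReal_inv_of_pos two_pos]
    simp
  have hq : ∀ n, gammaNorm E (x n - ι (Φ (x n))) ≤ ENNReal.ofReal (D * δ * (1 / 2) ^ n) := by
    intro n
    refine (hinv n).2.1.trans ?_
    rw [ENNReal.ofReal_mul (by positivity), ENNReal.ofReal_mul (by positivity),
      ENNReal.ofReal_coe_nnreal, mul_comm, hhalf]
    gcongr
  have hCq : ∀ n, C * gammaNorm E (x n - ι (Φ (x n))) ≤ ENNReal.ofReal (Q * (1 / 2) ^ n) := by
    intro n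
    rw [hQ, mul_assoc, ENNReal.ofReal_mul (by positivity), ENNReal.ofReal_coe_nnreal]
    gcongr
    exact hq n
  have hdist : ∀ n, dist (Φ (x n)) (Φ (x (n + 1))) ≤ Q * (1 / 2) ^ n := by
    intro n
    have h := (H.shift _ _ _ (hxρ n) (hsol n)).trans (hCq n)
    rw [← hxs, ← edist_eq_enorm_sub, edist_dist,
      ENNReal.ofReal_le_ofReal_iff (by positivity)] at h
    rwa [dist_comm]
  obtain ⟨e, he⟩ := cauchySeq_tendsto_of_complete
    (cauchySeq_of_le_geometric (1 / 2) Q (by norm_num) hdist)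
  have hde : ∀ n, cγ * ‖Φ (x n) - e‖ₑ ≤ ENNReal.ofReal (cγ * (2 * Q) * (1 / 2) ^ n) := by
    intro n
    have h := dist_le_of_le_geometric_of_tendsto (1 / 2) Q (by norm_num) hdist he n
    rw [mul_assoc, ENNReal.ofReal_mul (by positivity), ENNReal.ofReal_coe_nnreal,
      ← edist_eq_enorm_sub, edist_dist]
    gcongr
    refine h.trans_eq ?_
    ring
  have hxe : ∀ n, gammaNorm E (x n - ι e) ≤
      ENNReal.ofReal ((D * δ + cγ * (2 * Q)) * (1 / 2) ^ n) := by
    intro n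
    rw [add_mul, ENNReal.ofReal_add (by positivity) (by positivity),
      ← sub_add_sub_cancel (x n) (ι (Φ (x n))) (ι e), ← map_sub]
    exact (gammaNorm_add_le E _ _).trans (add_le_add (hq n) ((hcγ _).trans (hde n)))
  have hlim : Tendsto (fun n : ℕ => ENNReal.ofReal ((D * δ + cγ * (2 * Q)) * (1 / 2) ^ n))
      atTop (𝓝 0) := by
    have : Tendsto (fun n : ℕ => (D * δ + cγ * (2 * Q)) * (1 / 2 : ℝ) ^ n) atTop (𝓝 0) := by
      simpa using (tendsto_pow_atTop_nhds_zero_of_lt_one (by norm_num)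
        (by norm_num : (1 / 2 : ℝ) < 1)).const_mul (D * δ + cγ * (2 * Q))
    simpa using ENNReal.tendsto_ofReal this
  have hxelim : Tendsto (fun n => gammaNorm E (x n - ι e)) atTop (𝓝 0) :=
    tendsto_of_tendsto_of_tendsto_of_le_of_le tendsto_const_nhds hlim (fun _ => zero_le) hxe
  have heρ : gammaNorm E (ι e) < ENNReal.ofReal ρ := by
    have hρ : 0 < ENNReal.ofReal (ρ / 2) := by simpa using H.radius_pos
    obtain ⟨n, hn⟩ := (hxelim.eventually (Iio_mem_nhds hρ)).exists
    calc gammaNorm E (ι e) = gammaNorm E (x n - (x n - ι e)) := by rw [sub_sub_cancel]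
      _ ≤ gammaNorm E (x n) + gammaNorm E (x n - ι e) := gammaNorm_sub_le E _ _
      _ < ENNReal.ofReal (ρ / 2) + ENNReal.ofReal (ρ / 2) :=
        ENNReal.add_lt_add ((hxr n).trans_le hrρ) hn
      _ = ENNReal.ofReal ρ := by
        rw [← ENNReal.ofReal_add (by linarith [H.radius_pos]) (by linarith [H.radius_pos]),
          add_halves]
  have hΦe : Φ (ι e) = e := by
    refine tendsto_nhds_unique ?_ he
    rw [tendsto_iff_edist_tendsto_0]
    have hC0 : Tendsto (fun n => C * gammaNorm E (x n - ι e)) atTop (𝓝 0) := by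
      simpa using ENNReal.Tendsto.const_mul hxelim (Or.inr ENNReal.coe_ne_top)
    refine tendsto_of_tendsto_of_tendsto_of_le_of_le tendsto_const_nhds hC0
      (fun _ => zero_le) fun n => ?_
    simp only [edist_eq_enorm_sub]
    exact H.lipschitz _ _ (hxρ n) heρ
  refine ⟨e, by rw [← hΦe]; exact H.mem _ heρ, fun t ht => ?_⟩
  obtain ⟨n, s, hs, rfl⟩ := htime t ht
  rw [hWn n s hs]
  have hnear := (H.near _ _ _ (hxρ n) (hsol n) s (hIco s hs)).trans (hCq n)
  calc gammaNorm E ((p (x n)).2 s - ι e)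
      ≤ ENNReal.ofReal (Q * (1 / 2) ^ n) + ENNReal.ofReal (cγ * (2 * Q) * (1 / 2) ^ n) := by
        rw [← sub_add_sub_cancel _ (ι (Φ (x n))) (ι e), ← map_sub]
        exact (gammaNorm_add_le E _ _).trans (add_le_add hnear ((hcγ _).trans (hde n)))
    _ = ENNReal.ofReal (K * (1 / 2) ^ (n + 1)) := by
        rw [← ENNReal.ofReal_add (by positivity) (by positivity), hK, hQ, pow_succ]
        congr 1
        ring
    _ ≤ _ := by
        refine ENNReal.ofReal_le_ofReal (mul_le_mul_of_nonneg_left ?_ (by positivity))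
        have e1 : (1 / 2 : ℝ) ^ (n + 1) = Real.exp (-(Real.log 2 * (n + 1 : ℕ))) := by
          rw [mul_comm, ← mul_neg, Real.exp_nat_mul, Real.exp_neg, Real.exp_log two_pos, one_div]
        rw [e1, Real.exp_le_exp, neg_mul, neg_le_neg_iff, div_mul_eq_mul_div, mul_div_assoc]
        refine mul_le_mul_of_nonneg_left ?_ (Real.log_pos one_lt_two).le
        rw [div_le_iff₀ hT]
        push_cast
        linarith [hs.2]

/-- The equation `u' + F(u) = 0` is the shifted equation for the difference to the equilibrium. -/
theorem isGlobalSolution_iff {u₀ : X0} {U : ℝ → X0} :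
    IsGlobalSolution E F U₁ u₀ U ↔ ∃ v, ∀ t, 0 < t →
      SolvesShifted E F U₁ u (ENNReal.ofReal t) (u₀ - ι u) v (fun t => U t - ι u) := by
  have hmem : ∀ (t : ℝ) (w : ℝ → X1) (x : X1), (E.E1 (ENNReal.ofReal t)).nrm w < ∞ →
      (E.E1 (ENNReal.ofReal t)).nrm (fun s => w s + x) < ∞ := fun t w x hw => by
    obtain ⟨C, hC⟩ := E.const t
    exact ((E.E1 _).add_le _ _).trans_lt
      (ENNReal.add_lt_top.2 ⟨hw, (hC x).trans_lt (by finiteness)⟩)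
  constructor
  · rintro ⟨h0, w, hw⟩
    refine ⟨fun t => w t - u, fun t ht => ⟨?_, ?_, ?_, by simp [h0]⟩⟩
    · simpa only [sub_eq_add_neg] using hmem t w (-u) (hw t ht).1
    · simpa using (hw t ht).2.1
    · convert (hw t ht).2.2.sub (HasWeakDeriv.const u) using 2 with s
      simp [nonlin]
  · rintro ⟨v, hv⟩
    refine ⟨sub_left_injective (hv 1 one_pos).init, fun t => v t + u, fun t ht =>
      ⟨hmem t v u (hv t ht).mem, (hv t ht).dom, ?_⟩⟩
    convert (hv t ht).eqn.add (HasWeakDeriv.const u) using 2 with s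
    · simp
    · simp [nonlin]

end

end

end MaxReg

theorem theorem1 {X0 X1 : Type*}
    [NormedAddCommGroup X0] [NormedSpace ℝ X0] [CompleteSpace X0]
    [NormedAddCommGroup X1] [NormedSpace ℝ X1] [CompleteSpace X1]
    -- the dense embedding of `X1` in `X0`
    (ι : X1 →L[ℝ] X0) (hι : Function.Injective ι) (hdense : DenseRange ι)
    -- the nonlinearity and the equilibrium
    (k : ℕ) (hk : 1 ≤ k) (U₁ : Set X1) (hU₁ : IsOpen U₁)
    (F : X1 → X0) (hF : ContDiffOn ℝ k F U₁)
    (uS : X1) (huS : uS ∈ U₁) (hequil : F uS = 0)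
    (A : X1 →L[ℝ] X0) (hA : A = fderiv ℝ F uS)
    (S : ℝ → X0 →L[ℝ] X0) (hS : MaxReg.GeneratesAnalytic ι A S)
    -- normal stability
    (m : ℕ) (U : Set (EuclideanSpace ℝ (Fin m))) (Ψ : EuclideanSpace ℝ (Fin m) → X1)
    (hmanifold : MaxReg.IsEquilibriumManifold F U₁ uS m U Ψ)
    (htangent : LinearMap.range (fderiv ℝ Ψ 0 : EuclideanSpace ℝ (Fin m) →ₗ[ℝ] X1)
      = LinearMap.ker (A : X1 →ₗ[ℝ] X0))
    (hsemisimple : IsCompl (MaxReg.kerSpace ι A) (MaxReg.rangeSpace A))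
    (ω : ℝ) (hω : 0 < ω)
    (hspectrum : ∀ z ∈ MaxReg.complexSpectrum ι A, z ≠ 0 → ω < z.re)
    -- the function spaces and the conditions on them
    (E : MaxReg.FunctionSpacePair ι)
    (h1 : MaxReg.CondA1 E) (h2 : MaxReg.CondA2 E ω) (h3 : MaxReg.CondA3 E A)
    (h4 : MaxReg.CondA4 E A S hsemisimple ω)
    (h5 : MaxReg.CondA5 E F U₁ uS) (h6 : MaxReg.CondA6 E F U₁ uS) :
    -- stability in the trace space
    (∀ ε : ℝ, 0 < ε → ∃ δ : ℝ, 0 < δ ∧ ∀ u₀ : X0,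
      MaxReg.gammaNorm E (u₀ - ι uS) < ENNReal.ofReal δ →
      (∃ u, MaxReg.IsGlobalSolution E F U₁ u₀ u) ∧
      ∀ u, MaxReg.IsGlobalSolution E F U₁ u₀ u →
        ∀ t : ℝ, 0 ≤ t → MaxReg.gammaNorm E (u t - ι uS) < ENNReal.ofReal ε) ∧
    -- global existence, uniqueness, exponential convergence
    (∃ δ : ℝ, 0 < δ ∧ ∃ α : ℝ, 0 < α ∧ ∃ M : ℝ, ∀ u₀ : X0,
      MaxReg.gammaNorm E (u₀ - ι uS) < ENNReal.ofReal δ →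
      ∃ u, MaxReg.IsGlobalSolution E F U₁ u₀ u ∧
        (∀ u', MaxReg.IsGlobalSolution E F U₁ u₀ u' → ∀ t : ℝ, 0 ≤ t → u' t = u t) ∧
        ∃ uInf ∈ Ψ '' U, uInf ∈ U₁ ∧ F uInf = 0 ∧
          ∀ t : ℝ, 0 ≤ t →
            MaxReg.gammaNorm E (u t - ι uInf) ≤ ENNReal.ofReal (M * Real.exp (-α * t))) := by
  obtain ⟨T, Φ, C, ρ, H⟩ := MaxReg.exists_isContractiveStep hι hA hS hmanifold htangent
    hsemisimple hω h1 h2 h3 h4 h5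
  obtain ⟨δ, hδ, B, α, hα, K, hmain⟩ := H.exists_stable h1 h6
  -- solutions of the original equation, in terms of those of the shifted equation
  have hsolves : ∀ u₀ v V, (∀ t, 0 < t →
      MaxReg.SolvesShifted E F U₁ uS (ENNReal.ofReal t) (u₀ - ι uS) v V) →
      MaxReg.IsGlobalSolution E F U₁ u₀ (fun t => V t + ι uS) := fun u₀ v V hv =>
    (MaxReg.isGlobalSolution_iff (u := uS)).2 ⟨v, by simpa using hv⟩
  constructor
  · intro ε hε
    refine ⟨min δ (ε / (B + 1)), by positivity, fun u₀ hu₀ => ?_⟩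
    obtain ⟨v, V, hv, huniq, hbound, -⟩ :=
      hmain _ (hu₀.trans_le (ENNReal.ofReal_le_ofReal (min_le_left _ _)))
    refine ⟨⟨_, hsolves u₀ v V hv⟩, fun u hu t ht => ?_⟩
    obtain ⟨v', hv'⟩ := (MaxReg.isGlobalSolution_iff (u := uS)).1 hu
    rw [huniq _ _ hv' t ht]
    calc MaxReg.gammaNorm E (V t) ≤ (B + 1 : ℝ≥0) * MaxReg.gammaNorm E (u₀ - ι uS) :=
          (hbound t ht).trans (by gcongr; simp)
      _ < (B + 1 : ℝ≥0) * ENNReal.ofReal (ε / (B + 1)) :=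
          ENNReal.mul_lt_mul_right (by positivity) ENNReal.coe_ne_top
            (hu₀.trans_le (ENNReal.ofReal_le_ofReal (min_le_right _ _)))
      _ = ENNReal.ofReal ε := by
          rw [← ENNReal.ofReal_coe_nnreal, ← ENNReal.ofReal_mul (NNReal.coe_nonneg _)]
          congr 1
          push_cast
          field_simp
  · refine ⟨δ, hδ, α, hα, K, fun u₀ hu₀ => ?_⟩
    obtain ⟨v, V, hv, huniq, -, e, he, hconv⟩ := hmain _ hu₀
    refine ⟨_, hsolves u₀ v V hv, fun u hu t ht => ?_, e + uS, he, ?_, ?_, fun t ht => ?_⟩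
    · obtain ⟨v', hv'⟩ := (MaxReg.isGlobalSolution_iff (u := uS)).1 hu
      rw [← huniq _ _ hv' t ht, sub_add_cancel]
    · obtain ⟨ζ, hζ, hζe⟩ := he
      rw [← hζe]
      exact (hmanifold.equilibria ζ hζ).1
    · obtain ⟨ζ, hζ, hζe⟩ := he
      rw [← hζe]
      exact (hmanifold.equilibria ζ hζ).2
    · rw [map_add, add_sub_add_right_eq_sub]
      exact hconv t ht
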